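/- Let $n\ge 1$, $p>1$ and $0<\lambda\le\Lambda$. Write $B_1=\{x\in\mathbb R^n:|x|<1\}$ and $Q_1^-=B_1\times(-1,0]$, and for a symmetric $n\times n$ matrix $M$ with eigenvalues $e_1,\dots,e_n$ let $$\mathcal P^-_{\lambda,\Lambda}(M)=\lambda\sum_{e_i>0}e_i+\Lambda\sum_{e_i<0}e_i .$$ Here $D$, $D^2$ are the gradient and Hessian in $x$ only, and $\partial_t$ at $t=0$ is the left derivative. A function $\varphi$ touches $u:Q_1^-\to\mathbb R$ from below at $(x_0,t_0)\in Q_1^-$ if $\varphi(x,t)\le u(x,t)$ for all $(x,t)\in Q_1^-$ with $t\le t_0$ and $\varphi(x_0,t_0)=u(x_0,t_0)$. A lower semicontinuous function $u:Q_1^-\to\mathbb R$ is called a viscosity supersolution of $$\partial_t u-|Du|^{p-2}\mathcal P^-_{\lambda,\Lambda}(D^2u)\ge 0\quad\text{in } Q_1^-$$ if, whenever $\varphi\in C^2(Q_1^-)$ touches $u$ from below at $(x_0,t_0)\in Q_1^-$, one has at $(x_0,t_0)$ $$\partial_t\varphi-|D\varphi|^{p-2}\mathcal P^-_{\lambda,\Lambda}(D^2\varphi)\ge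 0 ,$$ where for $D\varphi(x_0,t_0)=0$ the factor $|D\varphi|^{p-2}$ is $0$ if $p>2$ and $1$ if $p=2$. If $1<p<2$ and $D\varphi(x_0,t_0)=0$, this inequality is replaced by the following (standard) requirement: $\partial_t\varphi(x_0,t_0)\ge 0$ whenever $\varphi$ is admissible at $(x_0,t_0)$, that is, whenever there are $\delta>0$, $f\in C^2([0,\infty))$ with $f(0)=f'(0)=f''(0)=0$, $f''>0$ on $(0,\infty)$ and $\lim_{r\to0^+}|f'(r)|^{p-2}f''(r)=0$, and $\sigma\in C^1(\mathbb R)$ with $\sigma(0)=\sigma'(0)=0$ and $\sigma(\tau)>0$ for $\tau\ne0$, such that $$|\varphi(x,t)-\varphi(x_0,t_0)-\partial_t\varphi(x_0,t_0)(t-t_0)|\le f(|x-x_0|)+\sigma(t-t_0)$$ for all $(x,t)\in Q_1^-$ with $|x-x_0|<\delta$ and $|t-t_0|<\delta$. Then there is a constant $c_0>0$, depending only on $n,p,\lambda,\Lambda$, such that every nonnegative viscosity supersolution $u$ of the above inequality in $Q_1^-$ with $u(0,0)\le 1$ satisfies $$\big|\{(x,t)\in Q_1^-:\ u(x,t)<4\}\big|\ge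 c_0 ,$$ where $|\cdot|$ is the $(n+1)$-dimensional Lebesgue measure. -/

import Mathlib

open Set Filter Topology MeasureTheory

noncomputable section

/-- Space-time `ℝⁿ × ℝ`, with the Euclidean norm on the space factor. -/
abbrev SpaceTime (n : ℕ) : Type := EuclideanSpace ℝ (Fin n) × ℝ

/-- The cylinder `U × (T₁, T₂]`. -/
def parabolicCylinder {n : ℕ} (U : Set (EuclideanSpace ℝ (Fin n))) (T₁ T₂ : ℝ) :
    Set (SpaceTime n) :=
  U ×ˢ Ioc T₁ T₂

/-- The backward unit cylinder `Q₁⁻ = B₁ × (-1, 0]`. -/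
def backwardUnitCylinder (n : ℕ) : Set (SpaceTime n) :=
  parabolicCylinder (Metric.ball (0 : EuclideanSpace ℝ (Fin n)) 1) (-1) 0

/-- The lower Pucci operator `P⁻(M) = lam * (sum of the positive eigenvalues)
+ Lam * (sum of the negative eigenvalues)`. The eigenvalues are taken with multiplicity, as the
roots of the characteristic polynomial; for symmetric `M` there are exactly `n` of them. -/
def pucciMinus {n : ℕ} (lam Lam : ℝ) (M : Matrix (Fin n) (Fin n) ℝ) : ℝ :=
  lam * (M.charpoly.roots.filter (fun e => 0 < e)).sum
    + Lam * (M.charpoly.roots.filter (fun e => e < 0)).sum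

/-- The gradient in space, `Dφ(x, t)`. -/
def spaceGradient {n : ℕ} (φ : SpaceTime n → ℝ) (z : SpaceTime n) : EuclideanSpace ℝ (Fin n) :=
  gradient (fun x => φ (x, z.2)) z.1

/-- The Hessian matrix in space, `D²φ(x, t)`. -/
def spaceHessian {n : ℕ} (φ : SpaceTime n → ℝ) (z : SpaceTime n) : Matrix (Fin n) (Fin n) ℝ :=
  Matrix.of fun i j =>
    fderiv ℝ (fderiv ℝ (fun x => φ (x, z.2))) z.1
      (EuclideanSpace.single i 1) (EuclideanSpace.single j 1)

/-- The time derivative `∂ₜφ(x, t)` of a function on `U × (T₁, T₂]`; it is the left derivative at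
the final time `t = T₂`, and the usual derivative for `T₁ < t < T₂`. -/
def timeDeriv {n : ℕ} (T₁ T₂ : ℝ) (φ : SpaceTime n → ℝ) (z : SpaceTime n) : ℝ :=
  derivWithin (fun t => φ (z.1, t)) (Ioc T₁ T₂) z.2

/-- `φ` touches `u : U × (T₁, T₂] → ℝ` from below at `z₀ = (x₀, t₀)`: `φ ≤ u` at all `(x, t)` of the
cylinder with `t ≤ t₀`, with equality at `z₀`. -/
def TouchesFromBelow {n : ℕ} (U : Set (EuclideanSpace ℝ (Fin n))) (T₁ T₂ : ℝ)
    (φ u : SpaceTime n → ℝ) (z₀ : SpaceTime n) : Prop :=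
  (∀ z ∈ parabolicCylinder U T₁ T₂, z.2 ≤ z₀.2 → φ z ≤ u z) ∧ φ z₀ = u z₀

/-- The radial profiles used for singular equations: `f ∈ C²([0, ∞))`,
`f(0) = f'(0) = f''(0) = 0`, `f'' > 0` on `(0, ∞)` and `|f'(r)|^(p-2) f''(r) → 0` as `r → 0+`.
Only the values on `[0, ∞)` matter, and such an `f` extends by zero to a `C²` function on `ℝ`, so
we take `f` of class `C²` on `ℝ`. -/
structure IsSingularProfile (p : ℝ) (f : ℝ → ℝ) : Prop where
  contDiff : ContDiff ℝ 2 f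
  map_zero : f 0 = 0
  deriv_zero : deriv f 0 = 0
  deriv_deriv_zero : deriv (deriv f) 0 = 0
  deriv_deriv_pos : ∀ r : ℝ, 0 < r → 0 < deriv (deriv f) r
  tendsto : Tendsto (fun r => |deriv f r| ^ (p - 2) * deriv (deriv f) r) (𝓝[>] 0) (𝓝 0)

/-- The time moduli used for singular equations: `σ ∈ C¹(ℝ)`, `σ(0) = σ'(0) = 0` and `σ > 0` away
from `0`. -/
structure IsTimeModulus (σ : ℝ → ℝ) : Prop where
  contDiff : ContDiff ℝ 1 σ
  map_zero : σ 0 = 0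
  deriv_zero : deriv σ 0 = 0
  pos : ∀ t : ℝ, t ≠ 0 → 0 < σ t

/-- Admissibility (Ohnuma-Sato) of a test function at a point `z₀ = (x₀, t₀)` where its spatial
gradient vanishes: near `z₀`,
`|φ(x, t) - φ(x₀, t₀) - ∂ₜφ(x₀, t₀) (t - t₀)| ≤ f(|x - x₀|) + σ(t - t₀)`. -/
def IsAdmissibleAt {n : ℕ} (p : ℝ) (U : Set (EuclideanSpace ℝ (Fin n))) (T₁ T₂ : ℝ)
    (φ : SpaceTime n → ℝ) (z₀ : SpaceTime n) : Prop :=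
  ∃ f σ : ℝ → ℝ, IsSingularProfile p f ∧ IsTimeModulus σ ∧ ∃ δ : ℝ, 0 < δ ∧
    ∀ z ∈ parabolicCylinder U T₁ T₂, ‖z.1 - z₀.1‖ < δ → |z.2 - z₀.2| < δ →
      |φ z - φ z₀ - timeDeriv T₁ T₂ φ z₀ * (z.2 - z₀.2)| ≤ f ‖z.1 - z₀.1‖ + σ (z.2 - z₀.2)

/-- Viscosity supersolutions of `∂ₜu - |Du|^(p-2) P⁻(D²u) ≥ 0` in `U × (T₁, T₂]` (`U` open, `p > 1`):
`u` is lower semicontinuous, and the inequality holds at `z₀` for every `φ ∈ C²(U × (T₁, T₂])` that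
touches `u` from below at `z₀`.

If `p ≥ 2` the operator makes sense for every gradient: at `Dφ = 0` the factor `|Dφ|^(p-2)` is `0`
for `p > 2` and `1` for `p = 2`, and these are the values of `Real.rpow`. If `1 < p < 2` the operator
is singular at `Dφ = 0`; there, as usual for singular equations, only admissible `φ` are tested, and
the inequality reads `∂ₜφ(z₀) ≥ 0`. -/
structure IsViscositySupersolution {n : ℕ} (p lam Lam : ℝ)
    (U : Set (EuclideanSpace ℝ (Fin n))) (T₁ T₂ : ℝ) (u : SpaceTime n → ℝ) : Prop where
  lowerSemicontinuousOn : LowerSemicontinuousOn u (parabolicCylinder U T₁ T₂)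
  regular : ∀ φ : SpaceTime n → ℝ, ContDiffOn ℝ 2 φ (parabolicCylinder U T₁ T₂) →
    ∀ z₀ ∈ parabolicCylinder U T₁ T₂, TouchesFromBelow U T₁ T₂ φ u z₀ →
      (2 ≤ p ∨ spaceGradient φ z₀ ≠ 0) →
      0 ≤ timeDeriv T₁ T₂ φ z₀
        - ‖spaceGradient φ z₀‖ ^ (p - 2) * pucciMinus lam Lam (spaceHessian φ z₀)
  singular : ∀ φ : SpaceTime n → ℝ, ContDiffOn ℝ 2 φ (parabolicCylinder U T₁ T₂) →
    ∀ z₀ ∈ parabolicCylinder U T₁ T₂, TouchesFromBelow U T₁ T₂ φ u z₀ →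
      p < 2 → spaceGradient φ z₀ = 0 → IsAdmissibleAt p U T₁ T₂ φ z₀ →
      0 ≤ timeDeriv T₁ T₂ φ z₀

end

/-! The proof slides the profiles `h + 8 t - A |x - y| ^ α`, with `α = p / (p - 1)`, under `u`, for
vertices `y` in a small ball and levels `h ∈ [2, 3]`. Each pair `(y, h)` has a first contact time
`t` with `u`, at a point `x` of the half-size cylinder where `u ≤ 3`. Let `T` be the set of pairs
`(y, t)` so obtained and `E` the set where `u ≤ 3` in that cylinder. The estimate follows by
computing `|T|` with Fubini in both orders.

For fixed `y`, the level is an `L`-Lipschitz function of the contact time, so the unit interval of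
levels forces the time fibre of `T` to have length at least `1 / L`. The reason is that `u`,
measured against a profile, cannot drop faster than some speed (`contactLevel_decay`). The exponent
`α` is chosen so that `|Dφ| ^ (p - 2) D²φ` is homogeneous of degree zero for `φ = -|x| ^ α`, which
gives one speed at every distance from the vertex. At the vertex itself the profile may fail to be
`C²` or admissible; there it is compared with a flatter power `|x| ^ (2k)` (`vertex_test`).

For fixed `t`, the vertex is a `C`-Lipschitz function of the contact point
(`exists_contact_lipschitz`). Two profiles in contact at nearby points with different slopes put a
convex kink under `u`. A steep convex paraboloid fitted in the kink would have to rise faster than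
its available time speed (`no_kink`), so the slope jump is controlled by the distance of the contact
points (`kink_le`), and the slope determines `x - y`. This uses no differentiability or
regularization of `u`.

Together, `|B| / L ≤ |T| ≤ C ^ n |E|`. -/

noncomputable section

/-! ### The field `|w|^(q-2) w`: continuity estimates and expansion of `|w|^q` -/

section PowVec

variable {F : Type*} [NormedAddCommGroup F] [InnerProductSpace ℝ F]

/-- The vector field `|w|^(q-2) w`, which is `1/q` times the gradient of `|w|^q`. -/
def powVec (q : ℝ) (w : F) : F := ‖w‖ ^ (q - 2) • w

theorem norm_powVec {q : ℝ} (hq : 1 < q) (w : F) : ‖powVec q w‖ = ‖w‖ ^ (q - 1) := by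
  rcases eq_or_ne w 0 with rfl | hw
  · simp [powVec, Real.zero_rpow (by linarith : q - 1 ≠ 0)]
  · have h : 0 < ‖w‖ := norm_pos_iff.2 hw
    rw [powVec, norm_smul, Real.norm_of_nonneg (by positivity), ← Real.rpow_add_one h.ne']
    congr 1; ring

theorem one_sub_rpow_le {s τ : ℝ} (hs : 0 < s) (h0 : 0 ≤ τ) (h1 : τ ≤ 1) :
    1 - τ ^ s ≤ (s + 1) * (1 - τ) := by
  rcases le_total 1 s with h | h
  · have := one_add_mul_self_le_rpow_one_add (s := τ - 1) (by linarith) h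
    rw [show 1 + (τ - 1) = τ by ring] at this
    nlinarith
  · have := Real.rpow_le_rpow_of_exponent_ge' h0 h1 hs.le h
    rw [Real.rpow_one] at this
    nlinarith

/-- The weight uses the larger norm, so the bound stays valid at `b = 0` for every `q > 1`, even
when `q - 2 < 0`. With `τ = ‖b‖ / ‖a‖` everything reduces to `|τ - τ ^ (q - 1)| ≤ (q + 1) (1 - τ)`.
-/
theorem norm_powVec_sub_le {q : ℝ} (hq : 1 < q) {a b : F} (hab : ‖b‖ ≤ ‖a‖) :
    ‖powVec q a - powVec q b‖ ≤ (q + 2) * ‖a‖ ^ (q - 2) * ‖a - b‖ := by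
  rcases eq_or_ne a 0 with rfl | ha
  · have : b = 0 := by simpa using hab
    simp [this, powVec]
  have hA : 0 < ‖a‖ := norm_pos_iff.2 ha
  set τ := ‖b‖ / ‖a‖ with hτ
  have hτ0 : 0 ≤ τ := by positivity
  have hτ1 : τ ≤ 1 := (div_le_one hA).2 hab
  have hB : ‖b‖ = τ * ‖a‖ := by rw [hτ]; field_simp
  have e1 : ‖a‖ ^ (q - 2) * ‖b‖ = ‖a‖ ^ (q - 2) * ‖a‖ * τ := by rw [hB]; ring
  have e2 : ‖b‖ ^ (q - 2) * ‖b‖ = ‖a‖ ^ (q - 2) * ‖a‖ * τ ^ (q - 1) := by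
    rcases eq_or_ne ‖b‖ 0 with h | h
    · have : τ = 0 := by rw [hτ, h]; simp
      rw [h, this, Real.zero_rpow (by linarith : q - 1 ≠ 0)]; simp
    · rw [← Real.rpow_add_one h, ← Real.rpow_add_one hA.ne',
        show q - 2 + 1 = q - 1 by ring, hB, Real.mul_rpow hτ0 hA.le]; ring
  have hs := one_sub_rpow_le (s := q - 1) (by linarith) hτ0 hτ1
  have hs' : τ ^ (q - 1) ≤ 1 := Real.rpow_le_one hτ0 hτ1 (by linarith)
  have hkey : |τ - τ ^ (q - 1)| ≤ (q + 1) * (1 - τ) := by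
    rw [abs_le]; constructor <;> nlinarith
  have hd : ‖a‖ * (1 - τ) ≤ ‖a - b‖ := by
    have := norm_sub_norm_le a b
    rw [hB] at this; linarith
  have hdec : powVec q a - powVec q b
      = ‖a‖ ^ (q - 2) • (a - b) + (‖a‖ ^ (q - 2) - ‖b‖ ^ (q - 2)) • b := by
    simp only [powVec, smul_sub, sub_smul]; abel
  have hP : 0 < ‖a‖ ^ (q - 2) := by positivity
  calc ‖powVec q a - powVec q b‖
      ≤ ‖a‖ ^ (q - 2) * ‖a - b‖ + |‖a‖ ^ (q - 2) - ‖b‖ ^ (q - 2)| * ‖b‖ := by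
        rw [hdec]; refine (norm_add_le _ _).trans ?_
        rw [norm_smul, norm_smul, Real.norm_of_nonneg hP.le, Real.norm_eq_abs]
    _ = ‖a‖ ^ (q - 2) * ‖a - b‖ + ‖a‖ ^ (q - 2) * ‖a‖ * |τ - τ ^ (q - 1)| := by
        congr 1
        rw [← abs_of_nonneg (norm_nonneg b), ← abs_mul, abs_of_nonneg (norm_nonneg b), sub_mul,
          e1, e2, ← mul_sub, abs_mul, abs_of_nonneg (by positivity : 0 ≤ ‖a‖ ^ (q - 2) * ‖a‖)]
    _ ≤ ‖a‖ ^ (q - 2) * ‖a - b‖ + ‖a‖ ^ (q - 2) * ((q + 1) * ‖a - b‖) := by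
        have : ‖a‖ * |τ - τ ^ (q - 1)| ≤ (q + 1) * ‖a - b‖ := by nlinarith
        have := mul_le_mul_of_nonneg_left this hP.le
        linarith
    _ = _ := by ring

theorem norm_powVec_sub_le_max {q : ℝ} (hq : 1 < q) (a b : F) :
    ‖powVec q a - powVec q b‖ ≤ (q + 2) * max ‖a‖ ‖b‖ ^ (q - 2) * ‖a - b‖ := by
  rcases le_total ‖b‖ ‖a‖ with h | h
  · rw [max_eq_left h]; exact norm_powVec_sub_le hq h
  · rw [max_eq_right h, norm_sub_rev, norm_sub_rev a]; exact norm_powVec_sub_le hq h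

theorem inner_powVec_self {q : ℝ} (hq : 1 < q) (w : F) :
    inner ℝ (powVec q w) w = ‖w‖ ^ q := by
  rw [powVec, real_inner_smul_left, real_inner_self_eq_norm_sq]
  rcases eq_or_ne w 0 with rfl | hw
  · simp [Real.zero_rpow (by linarith : q ≠ 0)]
  · have h : 0 < ‖w‖ := norm_pos_iff.2 hw
    rw [← Real.rpow_two, ← Real.rpow_add h]; congr 1; ring

/-- This is the gradient inequality for the convex function `|w| ^ q`, obtained from Cauchy-Schwarz
and Young without differentiating, so the origin needs no separate treatment. -/
theorem rpow_norm_sub_le_inner {q : ℝ} (hq : 1 < q) (a b : F) :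
    ‖a‖ ^ q - ‖b‖ ^ q ≤ q * inner ℝ (powVec q a) (a - b) := by
  have h1 : inner ℝ (powVec q a) b ≤ ‖a‖ ^ (q - 1) * ‖b‖ := by
    rw [← norm_powVec hq]; exact real_inner_le_norm _ _
  have hc : (q / (q - 1)).HolderConjugate q := (Real.HolderConjugate.conjExponent hq).symm
  have h2 := Real.young_inequality_of_nonneg (a := ‖a‖ ^ (q - 1)) (b := ‖b‖)
    (by positivity) (norm_nonneg _) hc
  rw [← Real.rpow_mul (norm_nonneg _), show (q - 1) * (q / (q - 1)) = q by
    field_simp [(by linarith : q - 1 ≠ 0)]] at h2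
  rw [inner_sub_right, inner_powVec_self hq]
  have h3 := h1.trans h2
  have h0 : (0 : ℝ) < q := by linarith
  have h4 := mul_le_mul_of_nonneg_left h3 h0.le
  have e : q * (‖a‖ ^ q / (q / (q - 1)) + ‖b‖ ^ q / q) = (q - 1) * ‖a‖ ^ q + ‖b‖ ^ q := by
    field_simp
  rw [e] at h4
  linarith

/-- Second order upper bound for `|w|^q`. -/
theorem rpow_norm_add_le {q : ℝ} (hq : 1 < q) (w z : F) :
    ‖w + z‖ ^ q ≤ ‖w‖ ^ q + q * inner ℝ (powVec q w) z
      + q * (q + 2) * max ‖w + z‖ ‖w‖ ^ (q - 2) * ‖z‖ ^ 2 := by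
  have h1 := rpow_norm_sub_le_inner hq (w + z) w
  rw [add_sub_cancel_left] at h1
  have h2 := norm_powVec_sub_le_max hq (w + z) w
  rw [add_sub_cancel_left] at h2
  have h3 : inner ℝ (powVec q (w + z) - powVec q w) z
      ≤ (q + 2) * max ‖w + z‖ ‖w‖ ^ (q - 2) * ‖z‖ * ‖z‖ :=
    (real_inner_le_norm _ _).trans (mul_le_mul_of_nonneg_right h2 (norm_nonneg _))
  rw [inner_sub_left] at h3
  have h4 := mul_le_mul_of_nonneg_left h3 (by linarith : 0 ≤ q)
  linarith

/-- The exponents `p` and `p / (p - 1)` are conjugate, so the two fields are mutually inverse. This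
lets the displacement `x - y` be recovered from the slope of a profile. -/
theorem powVec_powVec {p : ℝ} (hp : 1 < p) (w : F) : powVec p (powVec (p / (p - 1)) w) = w := by
  have hp' : p - 1 ≠ 0 := by linarith
  have hα : 1 < p / (p - 1) := by rw [lt_div_iff₀ (by linarith)]; linarith
  rcases eq_or_ne w 0 with rfl | hw
  · simp [powVec]
  · have h : 0 < ‖w‖ := norm_pos_iff.2 hw
    rw [powVec, norm_powVec hα, powVec, smul_smul, ← Real.rpow_mul h.le, ← Real.rpow_add h]
    have : (p / (p - 1) - 1) * (p - 2) + (p / (p - 1) - 2) = 0 := by field_simp; ring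
    rw [this, Real.rpow_zero, one_smul]

end PowVec


/-! ### Lower bounds for the Pucci operator -/

section Pucci

variable {n : ℕ}

theorem isRoot_charpoly_iff_exists_mulVec (M : Matrix (Fin n) (Fin n) ℝ) (t : ℝ) :
    M.charpoly.IsRoot t ↔ ∃ v ≠ 0, M.mulVec v = t • v := by
  rw [Polynomial.IsRoot.def, Matrix.eval_charpoly, ← Matrix.exists_mulVec_eq_zero_iff]
  refine exists_congr fun v => and_congr_right fun _ => ?_
  rw [Matrix.sub_mulVec, sub_eq_zero, eq_comm]
  simp [Matrix.scalar_apply, ← Matrix.smul_one_eq_diagonal, Matrix.smul_mulVec]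

/-- A real root `k` contributes at least `lam * k` to the positive part (trivially if `k ≤ 0`),
while the form bound keeps every real root above `-c` and there are at most `n` of them. -/
theorem le_pucciMinus {lam Lam : ℝ} (hlam : 0 < lam) (hLam : lam ≤ Lam)
    (M : Matrix (Fin n) (Fin n) ℝ) {c k : ℝ} (hc : 0 ≤ c)
    (hM : ∀ v : Fin n → ℝ, -c * (v ⬝ᵥ v) ≤ v ⬝ᵥ M.mulVec v) (hk : M.charpoly.IsRoot k) :
    lam * k - Lam * n * c ≤ pucciMinus lam Lam M := by
  have hM0 : M.charpoly ≠ 0 := M.charpoly_monic.ne_zero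
  have hroot : ∀ t ∈ M.charpoly.roots, -c ≤ t := by
    intro t ht
    obtain ⟨v, hv, hvt⟩ := (isRoot_charpoly_iff_exists_mulVec M t).1 (Polynomial.isRoot_of_mem_roots ht)
    have h1 := hM v
    rw [hvt, dotProduct_smul, smul_eq_mul] at h1
    have h2 : 0 < v ⬝ᵥ v := by
      have := Matrix.dotProduct_star_self_pos_iff.2 hv
      simpa using this
    exact le_of_mul_le_mul_right h1 h2
  have hpos : k ≤ (M.charpoly.roots.filter (fun e => 0 < e)).sum := by
    rcases le_or_gt k 0 with h | h
    · exact h.trans (Multiset.sum_nonneg fun x hx => (Multiset.mem_filter.1 hx).2.le)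
    · exact Multiset.single_le_sum (fun x hx => (Multiset.mem_filter.1 hx).2.le) k
        (Multiset.mem_filter.2 ⟨(Polynomial.mem_roots hM0).2 hk, h⟩)
  have hneg : -(n * c) ≤ (M.charpoly.roots.filter (fun e => e < 0)).sum := by
    have h1 : ((M.charpoly.roots.filter (fun e => e < 0)).card • (-c))
        ≤ (M.charpoly.roots.filter (fun e => e < 0)).sum :=
      Multiset.card_nsmul_le_sum fun x hx => hroot x (Multiset.mem_filter.1 hx).1
    have h2 : (M.charpoly.roots.filter (fun e => e < 0)).card ≤ n := by
      refine (Multiset.card_le_card (Multiset.filter_le _ _)).trans ?_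
      refine (Polynomial.card_roots' _).trans ?_
      rw [Matrix.charpoly_natDegree_eq_dim, Fintype.card_fin]
    have h3 : ((M.charpoly.roots.filter (fun e => e < 0)).card : ℝ) ≤ n := by exact_mod_cast h2
    rw [nsmul_eq_mul] at h1
    nlinarith
  rw [pucciMinus]
  nlinarith

/-- The lower Pucci operator of the Hessian of `s (e·x)² - σ |x|²` for a unit vector `e`. -/
theorem le_pucciMinus_rank_one {lam Lam : ℝ} (hlam : 0 < lam) (hLam : lam ≤ Lam)
    (e : EuclideanSpace ℝ (Fin n)) (he : ‖e‖ = 1) {s σ : ℝ} (hs : 0 ≤ s) (hσ : 0 ≤ σ) :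
    2 * lam * s - (2 * lam + 2 * Lam * n) * σ ≤ pucciMinus lam Lam
      (Matrix.of fun i j => 2 * s * (e i * e j) - 2 * σ * (if i = j then 1 else 0)) := by
  have hee : ∑ i, e i * e i = 1 := by
    have := EuclideanSpace.real_norm_sq_eq e
    rw [he] at this
    rw [← one_pow 2, this]; exact Finset.sum_congr rfl fun i _ => (sq _).symm
  have hmul : ∀ v : Fin n → ℝ, ∀ i, (Matrix.of fun i j =>
      2 * s * (e i * e j) - 2 * σ * (if i = j then 1 else 0) : Matrix (Fin n) (Fin n) ℝ).mulVec v i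
        = 2 * s * (∑ j, e j * v j) * e i - 2 * σ * v i := by
    intro v i
    simp only [Matrix.mulVec, dotProduct, Matrix.of_apply, sub_mul, Finset.sum_sub_distrib]
    congr 1
    · rw [Finset.mul_sum, Finset.sum_mul]; exact Finset.sum_congr rfl fun j _ => by ring
    · simp
  refine le_trans ?_ (le_pucciMinus hlam hLam _ (c := 2 * σ) (k := 2 * s - 2 * σ) (by positivity) ?_ ?_)
  · linarith
  · intro v
    have : v ⬝ᵥ (Matrix.of fun i j =>
      2 * s * (e i * e j) - 2 * σ * (if i = j then 1 else 0) : Matrix (Fin n) (Fin n) ℝ).mulVec v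
        = 2 * s * (∑ j, e j * v j) ^ 2 - 2 * σ * (v ⬝ᵥ v) := by
      simp only [dotProduct, hmul, mul_sub, Finset.sum_sub_distrib]
      congr 1
      · rw [sq, ← mul_assoc, Finset.mul_sum (a := 2 * s * ∑ j, e j * v j)]
        exact Finset.sum_congr rfl fun j _ => by ring
      · rw [Finset.mul_sum]; exact Finset.sum_congr rfl fun j _ => by ring
    rw [this]
    nlinarith [mul_nonneg hs (sq_nonneg (∑ j, e j * v j))]
  · rw [isRoot_charpoly_iff_exists_mulVec]
    refine ⟨e, ?_, ?_⟩
    · intro h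
      simp [h] at hee
    · ext i
      rw [hmul, hee]
      simp; ring

end Pucci


/-! ### Derivatives of the polynomial test functions -/

section TestFunction

variable {n : ℕ}

/-- A quadratic polynomial in space, corrected by a term of order `2k` in space and `2` in time. -/
def quadTest (x₀ : EuclideanSpace ℝ (Fin n)) (t₀ c : ℝ) (v e : EuclideanSpace ℝ (Fin n))
    (s σ K ν : ℝ) (k : ℕ) (z : SpaceTime n) : ℝ :=
  c + inner ℝ v (z.1 - x₀) + s * inner ℝ e (z.1 - x₀) ^ 2 - σ * ‖z.1 - x₀‖ ^ 2
    - K * (‖z.1 - x₀‖ ^ 2) ^ k + ν * (z.2 - t₀) - K * (z.2 - t₀) ^ 2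

theorem hasFDerivAt_inner_sub (x₀ w x : EuclideanSpace ℝ (Fin n)) :
    HasFDerivAt (fun x => inner ℝ w (x - x₀)) (innerSL ℝ w) x := by
  have := (innerSL ℝ w).hasFDerivAt.comp x ((hasFDerivAt_id x).sub_const x₀)
  exact this.congr_fderiv (by ext; simp)

variable (x₀ : EuclideanSpace ℝ (Fin n)) (t₀ c : ℝ) (v e : EuclideanSpace ℝ (Fin n))
    (s σ K ν : ℝ) (k : ℕ)

theorem contDiff_quadTest : ContDiff ℝ 2 (quadTest x₀ t₀ c v e s σ K ν k) := by
  unfold quadTest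
  have h : ContDiff ℝ 2 fun z : SpaceTime n => z.1 - x₀ := contDiff_fst.sub contDiff_const
  have h1 : ContDiff ℝ 2 fun z : SpaceTime n => ‖z.1 - x₀‖ ^ 2 := h.norm_sq ℝ
  have h2 : ContDiff ℝ 2 fun z : SpaceTime n => inner ℝ v (z.1 - x₀) := contDiff_const.inner ℝ h
  have h3 : ContDiff ℝ 2 fun z : SpaceTime n => inner ℝ e (z.1 - x₀) := contDiff_const.inner ℝ h
  fun_prop

theorem hasFDerivAt_quadTest (t : ℝ) (x : EuclideanSpace ℝ (Fin n)) :
    HasFDerivAt (fun x => quadTest x₀ t₀ c v e s σ K ν k (x, t))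
      (innerSL ℝ v + (2 * s * inner ℝ e (x - x₀)) • innerSL ℝ e
        - (2 * σ + 2 * K * k * (‖x - x₀‖ ^ 2) ^ (k - 1)) • innerSL ℝ (x - x₀)) x := by
  have h0 : HasFDerivAt (fun x => x - x₀) (ContinuousLinearMap.id ℝ (EuclideanSpace ℝ (Fin n))) x :=
    (hasFDerivAt_id x).sub_const x₀
  have hi := fun w => hasFDerivAt_inner_sub x₀ w x
  have hn := h0.norm_sq
  have := ((((((hi v).const_add c).add (((hi e).pow 2).const_mul s)).sub (hn.const_mul σ)).sub
    ((hn.pow k).const_mul K)).add_const (ν * (t - t₀))).sub_const (K * (t - t₀) ^ 2)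
  refine this.congr_fderiv ?_
  ext w
  simp
  ring

theorem spaceGradient_quadTest (t : ℝ) :
    spaceGradient (quadTest x₀ t₀ c v e s σ K ν k) (x₀, t) = v := by
  have h := hasFDerivAt_quadTest x₀ t₀ c v e s σ K ν k t x₀
  refine HasGradientAt.gradient ?_
  rw [hasGradientAt_iff_hasFDerivAt]
  refine h.congr_fderiv ?_
  ext w
  simp

/-- Since `k ≥ 2`, the correction of order `2k` has zero Hessian at `x₀`, so `K` can be taken large
without affecting the tested inequality. -/
theorem spaceHessian_quadTest (t : ℝ) (hk : 2 ≤ k) :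
    spaceHessian (quadTest x₀ t₀ c v e s σ K ν k) (x₀, t)
      = Matrix.of fun i j => 2 * s * (e i * e j) - 2 * σ * (if i = j then 1 else 0) := by
  set f := fun x => quadTest x₀ t₀ c v e s σ K ν k (x, t) with hf
  have hfc : ContDiff ℝ 2 f :=
    (contDiff_quadTest x₀ t₀ c v e s σ K ν k).comp (contDiff_prodMk_left t)
  have hd : DifferentiableAt ℝ (fderiv ℝ f) x₀ :=
    ((hfc.fderiv_right (m := 1) (by norm_num)).differentiable (by norm_num)) x₀
  have h0 : HasFDerivAt (fun x => x - x₀) (ContinuousLinearMap.id ℝ (EuclideanSpace ℝ (Fin n))) x₀ :=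
    (hasFDerivAt_id x₀).sub_const x₀
  have hi := fun w => hasFDerivAt_inner_sub x₀ w x₀
  have key : ∀ u w : EuclideanSpace ℝ (Fin n), fderiv ℝ (fderiv ℝ f) x₀ u w
      = 2 * s * (inner ℝ e u * inner ℝ e w) - 2 * σ * inner ℝ w u := by
    intro u w
    have h1 : HasFDerivAt (fun x => fderiv ℝ f x w) ((fderiv ℝ (fderiv ℝ f) x₀).flip w) x₀ := by
      have := hd.hasFDerivAt.clm_apply (hasFDerivAt_const w x₀)
      simpa using this
    have h2 : HasFDerivAt (fun x => fderiv ℝ f x w)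
        ((2 * s * inner ℝ e w) • innerSL ℝ e - (2 * σ) • innerSL ℝ w) x₀ := by
      have he : (fun x => fderiv ℝ f x w) = fun x => inner ℝ v w
          + 2 * s * inner ℝ e w * inner ℝ e (x - x₀)
          - (2 * σ + 2 * K * k * (‖x - x₀‖ ^ 2) ^ (k - 1)) * inner ℝ w (x - x₀) := by
        funext x
        rw [(hasFDerivAt_quadTest x₀ t₀ c v e s σ K ν k t x).fderiv]
        simp only [sub_apply, add_apply, smul_apply,
          innerSL_apply_apply, smul_eq_mul]
        rw [real_inner_comm w (x - x₀)]
        ring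
      rw [he]
      have hn := ((((h0.norm_sq).pow (k - 1)).const_mul (2 * K * k)).const_add (2 * σ)).mul (hi w)
      refine ((((hi e).const_mul (2 * s * inner ℝ e w)).const_add (inner ℝ v w)).sub hn).congr_fderiv ?_
      ext u
      have : k - 1 ≠ 0 := by omega
      simp [this]
    have h3 := h1.unique h2
    have h4 := congrArg (fun L => L u) h3
    simp at h4
    rw [h4]
    ring
  ext i j
  simp only [spaceHessian, Matrix.of_apply]
  rw [key]
  simp [EuclideanSpace.inner_single_right]

theorem timeDeriv_quadTest (x : EuclideanSpace ℝ (Fin n)) {T₁ T₂ : ℝ} (ht : t₀ ∈ Ioc T₁ T₂) :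
    timeDeriv T₁ T₂ (quadTest x₀ t₀ c v e s σ K ν k) (x, t₀) = ν := by
  have h : HasDerivAt (fun t => quadTest x₀ t₀ c v e s σ K ν k (x, t)) ν t₀ := by
    have h0 : HasDerivAt (fun t => t - t₀) 1 t₀ := (hasDerivAt_id t₀).sub_const t₀
    have := ((h0.const_mul ν).const_add (c + inner ℝ v (x - x₀) + s * inner ℝ e (x - x₀) ^ 2
      - σ * ‖x - x₀‖ ^ 2 - K * (‖x - x₀‖ ^ 2) ^ k)).sub ((h0.pow 2).const_mul K)
    refine this.congr_deriv ?_
    simp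
  exact h.hasDerivWithinAt.derivWithin (uniqueDiffOn_Ioc T₁ T₂ t₀ ht)

end TestFunction


/-! ### The supersolution inequality for local minorants -/

section TestInequality

/-- The quantity `|f'| ^ (p - 2) f''` is a multiple of `r ^ ((2k - 1)(p - 1) - 1)`; `hkp` says
exactly that this exponent is positive. -/
theorem isSingularProfile_pow {p K : ℝ} (hK : 0 < K) {k : ℕ} (hk : 2 ≤ k)
    (hkp : 1 < (2 * k - 1) * (p - 1)) : IsSingularProfile p fun r => K * r ^ (2 * k) := by
  have d1 : deriv (fun r : ℝ => K * r ^ (2 * k)) = fun r => K * (2 * k) * r ^ (2 * k - 1) := by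
    funext r
    simp
    ring
  have d2 : deriv (deriv (fun r : ℝ => K * r ^ (2 * k)))
      = fun r => K * (2 * k) * (2 * k - 1) * r ^ (2 * k - 2) := by
    rw [d1]
    funext r
    have : ((2 * k - 1 : ℕ) : ℝ) = 2 * k - 1 := by
      rw [Nat.cast_sub (by omega)]; push_cast; ring
    simp [this, Nat.sub_sub]
    ring
  have hk' : (2 : ℝ) ≤ k := by exact_mod_cast hk
  refine ⟨by fun_prop, ?_, ?_, ?_, ?_, ?_⟩
  · simp; omega
  · rw [d1]; simp; omega
  · rw [d2]; simp; omega
  · intro r hr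
    rw [d2]
    have : (0 : ℝ) < 2 * k - 1 := by linarith
    positivity
  · rw [d2, d1]
    have hγ : 0 < (2 * k - 1) * (p - 1) - 1 := by linarith
    have h1 : Tendsto (fun r : ℝ => (K * (2 * k)) ^ (p - 2) * (K * (2 * k) * (2 * k - 1))
        * r ^ ((2 * k - 1) * (p - 1) - 1)) (𝓝[>] 0) (𝓝 0) := by
      have := ((Real.continuousAt_rpow_const 0 _ (Or.inr hγ.le)).tendsto.const_mul
        ((K * (2 * k)) ^ (p - 2) * (K * (2 * k) * (2 * k - 1)))).mono_left
        (nhdsWithin_le_nhds (s := Ioi (0 : ℝ)))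
      rwa [Real.zero_rpow hγ.ne', mul_zero] at this
    refine h1.congr' ?_
    filter_upwards [self_mem_nhdsWithin] with r hr
    have hr : 0 < r := hr
    rw [abs_of_nonneg (by positivity),
      Real.mul_rpow (x := K * (2 * k)) (by positivity) (by positivity)]
    have e1 : (r ^ (2 * k - 1)) ^ (p - 2) = r ^ ((2 * k - 1 : ℝ) * (p - 2)) := by
      rw [← Real.rpow_natCast, ← Real.rpow_mul hr.le, Nat.cast_sub (by omega)]
      push_cast; rfl
    have e2 : r ^ (2 * k - 2) = r ^ (2 * k - 2 : ℝ) := by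
      rw [← Real.rpow_natCast, Nat.cast_sub (by omega)]
      push_cast; rfl
    have e3 : r ^ ((2 * k - 1 : ℝ) * (p - 1) - 1)
        = r ^ ((2 * k - 1 : ℝ) * (p - 2)) * r ^ (2 * k - 2 : ℝ) := by
      rw [← Real.rpow_add hr]; congr 1; ring
    rw [e1, e2, e3]
    ring

theorem isTimeModulus_sq {K : ℝ} (hK : 0 < K) : IsTimeModulus fun t => K * t ^ 2 := by
  refine ⟨by fun_prop, by simp, by simp, fun t ht => by positivity⟩

variable {n : ℕ} {p lam Lam : ℝ} {u : SpaceTime n → ℝ}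

/-- A local quadratic minorant at `z₀` (in the past) extends to a global test function. -/
theorem exists_touchesFromBelow_quadTest (hu0 : ∀ z ∈ backwardUnitCylinder n, 0 ≤ u z)
    {x₀ : EuclideanSpace ℝ (Fin n)} {t₀ : ℝ} (hz : (x₀, t₀) ∈ backwardUnitCylinder n)
    {v e : EuclideanSpace ℝ (Fin n)} {s σ B ν δ : ℝ} {k : ℕ} (hk : 2 ≤ k) (hδ : 0 < δ)
    (hloc : ∀ x τ, (x, τ) ∈ backwardUnitCylinder n → ‖x - x₀‖ < δ → t₀ - δ < τ → τ ≤ t₀ →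
      u (x₀, t₀) + inner ℝ v (x - x₀) + s * inner ℝ e (x - x₀) ^ 2 - σ * ‖x - x₀‖ ^ 2
        - B * (‖x - x₀‖ ^ 2) ^ k + ν * (τ - t₀) ≤ u (x, τ)) :
    ∃ K > 0, TouchesFromBelow (Metric.ball (0 : EuclideanSpace ℝ (Fin n)) 1) (-1) 0
      (quadTest x₀ t₀ (u (x₀, t₀)) v e s σ K ν k) u (x₀, t₀) := by
  set C := |u (x₀, t₀)| + 2 * ‖v‖ + |s| * (2 * ‖e‖) ^ 2 + |σ| * 4 + |ν| with hC
  have hC0 : 0 ≤ C := by positivity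
  -- Away from `(x₀, t₀)` either `‖x - x₀‖ ≥ δ` or `t₀ - τ ≥ δ`. The two quotients make the
  -- corresponding correction at least `C`, which bounds the rest of the test function on the
  -- cylinder; then `u ≥ 0` suffices.
  set K := |B| + C / (δ ^ 2) ^ k + C / δ ^ 2 + 1 with hK
  have hKB : B ≤ K := by
    have := le_abs_self B
    have h1 : 0 ≤ C / (δ ^ 2) ^ k := by positivity
    have h2 : 0 ≤ C / δ ^ 2 := by positivity
    linarith
  have hK0 : 0 < K := by positivity
  refine ⟨K, hK0, ?_, ?_⟩
  · rintro ⟨x, τ⟩ hx hτ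
    have hτ : τ ≤ t₀ := hτ
    simp only [quadTest]
    by_cases h : ‖x - x₀‖ < δ ∧ t₀ - δ < τ
    · have h1 := hloc x τ hx h.1 h.2 hτ
      have h2 : B * (‖x - x₀‖ ^ 2) ^ k ≤ K * (‖x - x₀‖ ^ 2) ^ k := by gcongr
      have h3 : 0 ≤ K * (τ - t₀) ^ 2 := by positivity
      linarith
    · have hx1 : ‖x‖ < 1 := by simpa using hx.1
      have hx2 : ‖x₀‖ < 1 := by simpa using hz.1
      have hτ1 : -1 < τ := hx.2.1
      have ht2 : t₀ ≤ 0 := hz.2.2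
      have hd : ‖x - x₀‖ ≤ 2 := (norm_sub_le _ _).trans (by linarith)
      have b1 : inner ℝ v (x - x₀) ≤ 2 * ‖v‖ := (real_inner_le_norm _ _).trans (by nlinarith [norm_nonneg v])
      have b2 : s * inner ℝ e (x - x₀) ^ 2 ≤ |s| * (2 * ‖e‖) ^ 2 := by
        have h1 : inner ℝ e (x - x₀) ^ 2 ≤ (2 * ‖e‖) ^ 2 := by
          rw [sq_le_sq, abs_of_nonneg (by positivity : 0 ≤ 2 * ‖e‖)]
          exact (abs_real_inner_le_norm _ _).trans (by nlinarith [norm_nonneg e])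
        exact mul_le_mul (le_abs_self s) h1 (by positivity) (by positivity)
      have b3 : -(σ * ‖x - x₀‖ ^ 2) ≤ |σ| * 4 := by
        have h1 : ‖x - x₀‖ ^ 2 ≤ 4 := by nlinarith [norm_nonneg (x - x₀)]
        rw [← neg_mul]
        exact mul_le_mul (neg_le_abs σ) h1 (by positivity) (by positivity)
      have b4 : ν * (τ - t₀) ≤ |ν| := by
        have h1 : -ν * (t₀ - τ) ≤ |ν| * 1 :=
          mul_le_mul (neg_le_abs ν) (by linarith) (by linarith) (by positivity)
        linarith
      have b5 := le_abs_self (u (x₀, t₀))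
      have b6 : C ≤ K * (‖x - x₀‖ ^ 2) ^ k + K * (τ - t₀) ^ 2 := by
        rcases not_and_or.1 h with h | h
        · have h1 : (δ ^ 2) ^ k ≤ (‖x - x₀‖ ^ 2) ^ k := by
            have := not_lt.1 h
            gcongr
          have h2 : C / (δ ^ 2) ^ k ≤ K := by
            have h2 : 0 ≤ C / δ ^ 2 := by positivity
            linarith [abs_nonneg B]
          have h3 := (div_le_iff₀ (by positivity)).1 h2
          nlinarith [sq_nonneg (τ - t₀)]
        · have h1 : δ ^ 2 ≤ (τ - t₀) ^ 2 := by nlinarith [not_lt.1 h]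
          have h2 : C / δ ^ 2 ≤ K := by
            have h2 : 0 ≤ C / (δ ^ 2) ^ k := by positivity
            linarith [abs_nonneg B]
          have h3 := (div_le_iff₀ (by positivity)).1 h2
          have h4 : 0 ≤ K * (‖x - x₀‖ ^ 2) ^ k := by positivity
          nlinarith
      have := hu0 (x, τ) hx
      linarith
  · have : k ≠ 0 := by omega
    simp [quadTest, this]

theorem IsViscositySupersolution.quadratic_test (hu : IsViscositySupersolution p lam Lam
      (Metric.ball (0 : EuclideanSpace ℝ (Fin n)) 1) (-1) 0 u)
    (hlam : 0 < lam) (hLam : lam ≤ Lam)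
    (hu0 : ∀ z ∈ backwardUnitCylinder n, 0 ≤ u z)
    {x₀ : EuclideanSpace ℝ (Fin n)} {t₀ : ℝ} (hz : (x₀, t₀) ∈ backwardUnitCylinder n)
    {v e : EuclideanSpace ℝ (Fin n)} (he : ‖e‖ = 1) {s σ B ν δ : ℝ} (hs : 0 ≤ s) (hσ : 0 ≤ σ)
    {k : ℕ} (hk : 2 ≤ k) (hδ : 0 < δ) (hv : 2 ≤ p ∨ v ≠ 0)
    (hloc : ∀ x τ, (x, τ) ∈ backwardUnitCylinder n → ‖x - x₀‖ < δ → t₀ - δ < τ → τ ≤ t₀ →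
      u (x₀, t₀) + inner ℝ v (x - x₀) + s * inner ℝ e (x - x₀) ^ 2 - σ * ‖x - x₀‖ ^ 2
        - B * (‖x - x₀‖ ^ 2) ^ k + ν * (τ - t₀) ≤ u (x, τ)) :
    ‖v‖ ^ (p - 2) * (2 * lam * s - (2 * lam + 2 * Lam * n) * σ) ≤ ν := by
  obtain ⟨K, hK, htouch⟩ := exists_touchesFromBelow_quadTest hu0 hz hk hδ hloc
  have h := hu.regular _ (contDiff_quadTest _ _ _ _ _ _ _ _ _ _).contDiffOn _ hz htouch
    (by rwa [spaceGradient_quadTest])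
  rw [spaceGradient_quadTest, spaceHessian_quadTest _ _ _ _ _ _ _ _ _ _ _ hk,
    timeDeriv_quadTest _ _ _ _ _ _ _ _ _ _ _ hz.2] at h
  have h1 := mul_le_mul_of_nonneg_left (le_pucciMinus_rank_one hlam hLam e he hs hσ)
    (Real.rpow_nonneg (norm_nonneg v) (p - 2))
  linarith

/-- For `p ≥ 2` this is the regular inequality with zero gradient and zero Hessian. For `p < 2` the
deviation of the test function from its linear part in time is exactly `-(K |x - x₀| ^ (2k) + K (τ -
t₀) ^ 2)`, which supplies its own admissibility moduli. -/
theorem IsViscositySupersolution.critical_test (hu : IsViscositySupersolution p lam Lam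
      (Metric.ball (0 : EuclideanSpace ℝ (Fin n)) 1) (-1) 0 u) (hn : 1 ≤ n)
    (hlam : 0 < lam) (hLam : lam ≤ Lam)
    (hu0 : ∀ z ∈ backwardUnitCylinder n, 0 ≤ u z)
    {x₀ : EuclideanSpace ℝ (Fin n)} {t₀ : ℝ} (hz : (x₀, t₀) ∈ backwardUnitCylinder n)
    {B ν δ : ℝ} {k : ℕ} (hk : 2 ≤ k) (hkp : 1 < (2 * k - 1) * (p - 1)) (hδ : 0 < δ)
    (hloc : ∀ x τ, (x, τ) ∈ backwardUnitCylinder n → ‖x - x₀‖ < δ → t₀ - δ < τ → τ ≤ t₀ →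
      u (x₀, t₀) - B * (‖x - x₀‖ ^ 2) ^ k + ν * (τ - t₀) ≤ u (x, τ)) :
    0 ≤ ν := by
  set e : EuclideanSpace ℝ (Fin n) := EuclideanSpace.single ⟨0, hn⟩ 1
  have he : ‖e‖ = 1 := by simp [e]
  have hloc' : ∀ x τ, (x, τ) ∈ backwardUnitCylinder n → ‖x - x₀‖ < δ → t₀ - δ < τ → τ ≤ t₀ →
      u (x₀, t₀) + inner ℝ (0 : EuclideanSpace ℝ (Fin n)) (x - x₀) + 0 * inner ℝ e (x - x₀) ^ 2
        - 0 * ‖x - x₀‖ ^ 2 - B * (‖x - x₀‖ ^ 2) ^ k + ν * (τ - t₀) ≤ u (x, τ) := by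
    intro x τ hx h1 h2 h3
    simpa using hloc x τ hx h1 h2 h3
  rcases le_or_gt 2 p with hp | hp
  · simpa using hu.quadratic_test hlam hLam hu0 hz he le_rfl le_rfl hk hδ (Or.inl hp) hloc'
  · obtain ⟨K, hK, htouch⟩ := exists_touchesFromBelow_quadTest hu0 hz hk hδ hloc'
    have h := hu.singular _ (contDiff_quadTest _ _ _ _ _ _ _ _ _ _).contDiffOn _ hz htouch hp
      (by rw [spaceGradient_quadTest]) ?_
    · rwa [timeDeriv_quadTest _ _ _ _ _ _ _ _ _ _ _ hz.2] at h
    · refine ⟨_, _, isSingularProfile_pow hK hk hkp, isTimeModulus_sq hK, 1, one_pos, ?_⟩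
      rintro ⟨x, τ⟩ - - -
      rw [timeDeriv_quadTest _ _ _ _ _ _ _ _ _ _ _ hz.2]
      have hk0 : k ≠ 0 := by omega
      simp only [quadTest, pow_mul]
      have e1 : u (x₀, t₀) + inner ℝ (0 : EuclideanSpace ℝ (Fin n)) (x - x₀)
          + 0 * inner ℝ e (x - x₀) ^ 2 - 0 * ‖x - x₀‖ ^ 2 - K * (‖x - x₀‖ ^ 2) ^ k
          + ν * (τ - t₀) - K * (τ - t₀) ^ 2
          - (u (x₀, t₀) + inner ℝ (0 : EuclideanSpace ℝ (Fin n)) (x₀ - x₀)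
          + 0 * inner ℝ e (x₀ - x₀) ^ 2 - 0 * ‖x₀ - x₀‖ ^ 2 - K * (‖x₀ - x₀‖ ^ 2) ^ k
          + ν * (t₀ - t₀) - K * (t₀ - t₀) ^ 2) - ν * (τ - t₀)
          = -(K * (‖x - x₀‖ ^ 2) ^ k + K * (τ - t₀) ^ 2) := by
        simp [hk0]; ring
      rw [e1, abs_neg, abs_of_nonneg (by positivity)]

end TestInequality


/-! ### Bounded speed of decrease of the contact level -/

section Decay

/-- The constant in the second order upper bound for `|w|^q` at comparable scales. -/
def powConst (q : ℝ) : ℝ := q * (q + 2) * 2 ^ |q - 2|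

theorem powConst_pos {q : ℝ} (hq : 1 < q) : 0 < powConst q := by
  unfold powConst
  have : 0 < q := by linarith
  positivity

theorem rpow_le_of_comparable {d M a : ℝ} (hd : 0 < d) (h1 : d / 2 ≤ M) (h2 : M ≤ 2 * d) :
    M ^ a ≤ 2 ^ |a| * d ^ a := by
  rcases le_total 0 a with h | h
  · rw [abs_of_nonneg h, ← Real.mul_rpow (by norm_num) hd.le]
    exact Real.rpow_le_rpow (by linarith) h2 h
  · rw [abs_of_nonpos h, Real.rpow_neg (by norm_num), ← Real.inv_rpow (by norm_num),
      ← Real.mul_rpow (by norm_num) hd.le]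
    exact Real.rpow_le_rpow_of_nonpos (by positivity) (by linarith) h

theorem rpow_norm_add_le_of_comparable {F : Type*} [NormedAddCommGroup F] [InnerProductSpace ℝ F]
    {q d : ℝ} (hq : 1 < q) (hd : 0 < d) {w z : F} (h1 : d / 2 ≤ ‖w‖) (h2 : ‖w‖ ≤ d)
    (hz : ‖z‖ ≤ d) :
    ‖w + z‖ ^ q ≤ ‖w‖ ^ q + q * inner ℝ (powVec q w) z
      + powConst q * d ^ (q - 2) * ‖z‖ ^ 2 := by
  refine (rpow_norm_add_le hq w z).trans ?_
  have h3 : max ‖w + z‖ ‖w‖ ≤ 2 * d :=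
    max_le ((norm_add_le _ _).trans (by linarith)) (by linarith)
  have h4 := rpow_le_of_comparable (a := q - 2) hd (h1.trans (le_max_right ‖w + z‖ _)) h3
  have h5 := mul_le_mul_of_nonneg_left h4
    (by have : 0 < q := by linarith
        positivity : 0 ≤ q * (q + 2) * ‖z‖ ^ 2)
  unfold powConst
  linarith

variable {n : ℕ} {p lam Lam : ℝ} {u : SpaceTime n → ℝ}

/-- The constant bounding `|Dφ|^(p-2) P⁻(D²φ)` from below for `φ = -|x|^q`. -/
def speedConst (n : ℕ) (p lam Lam q : ℝ) : ℝ :=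
  q ^ (p - 2) * powConst q * (2 * lam + 2 * Lam * n)

theorem speedConst_nonneg (hlam : 0 < lam) (hLam : lam ≤ Lam) {q : ℝ} (hq : 1 < q) :
    0 ≤ speedConst n p lam Lam q := by
  have := powConst_pos hq
  have : 0 < q := by linarith
  have : 0 < Lam := by linarith
  unfold speedConst
  positivity

/-- Touching from below by `ν t - B |x - y|^q` away from the vertex bounds `ν` from below. -/
theorem IsViscositySupersolution.power_test (hu : IsViscositySupersolution p lam Lam
      (Metric.ball (0 : EuclideanSpace ℝ (Fin n)) 1) (-1) 0 u) (hn : 1 ≤ n)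
    (hlam : 0 < lam) (hLam : lam ≤ Lam)
    (hu0 : ∀ z ∈ backwardUnitCylinder n, 0 ≤ u z)
    {x₀ : EuclideanSpace ℝ (Fin n)} {t₀ : ℝ} (hz : (x₀, t₀) ∈ backwardUnitCylinder n)
    {w : EuclideanSpace ℝ (Fin n)} (hw : w ≠ 0) {q B ν δ : ℝ} (hq : 1 < q) (hB : 0 < B)
    (hδ : 0 < δ)
    (hloc : ∀ x τ, (x, τ) ∈ backwardUnitCylinder n → ‖x - x₀‖ < δ → t₀ - δ < τ → τ ≤ t₀ →
      u (x₀, t₀) + ν * (τ - t₀) - B * (‖w + (x - x₀)‖ ^ q - ‖w‖ ^ q) ≤ u (x, τ)) :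
    -(speedConst n p lam Lam q * B ^ (p - 1) * ‖w‖ ^ (q * (p - 1) - p)) ≤ ν := by
  set e : EuclideanSpace ℝ (Fin n) := EuclideanSpace.single ⟨0, hn⟩ 1
  have he : ‖e‖ = 1 := by simp [e]
  have hw0 : 0 < ‖w‖ := norm_pos_iff.2 hw
  have hq0 : 0 < q := by linarith
  have hK := powConst_pos hq
  set v := -((B * q) • powVec q w) with hv
  have hvn : ‖v‖ = B * q * ‖w‖ ^ (q - 1) := by
    rw [hv, norm_neg, norm_smul, norm_powVec hq, Real.norm_of_nonneg (by positivity)]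
  have hv0 : v ≠ 0 := by rw [← norm_pos_iff, hvn]; positivity
  have h := hu.quadratic_test hlam hLam hu0 hz he (v := v) (s := 0)
    (σ := B * powConst q * ‖w‖ ^ (q - 2)) (B := 0) (ν := ν) (δ := min δ ‖w‖) (k := 2) le_rfl
    (by positivity) le_rfl (lt_min hδ hw0) (Or.inr hv0) ?_
  · refine le_trans (le_of_eq ?_) h
    have e1 : ‖w‖ ^ (q * (p - 1) - p) = ‖w‖ ^ ((q - 1) * (p - 2)) * ‖w‖ ^ (q - 2) := by
      rw [← Real.rpow_add hw0]; congr 1; ring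
    have e2 : B ^ (p - 1) = B ^ (p - 2) * B := by
      rw [← Real.rpow_add_one hB.ne']; congr 1; ring
    rw [hvn, Real.mul_rpow (by positivity) (by positivity), Real.mul_rpow hB.le hq0.le,
      ← Real.rpow_mul hw0.le, e1, e2, speedConst]
    ring
  · intro x τ hx h1 h2 h3
    refine le_trans ?_ (hloc x τ hx (h1.trans_le (min_le_left _ _)) ?_ h3)
    · have h4 := rpow_norm_add_le_of_comparable hq hw0 (w := w) (z := x - x₀) (by linarith) le_rfl
        (h1.le.trans (min_le_right _ _))
      have h5 := mul_le_mul_of_nonneg_left h4 hB.le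
      have h6 : inner ℝ v (x - x₀) = -(B * q * inner ℝ (powVec q w) (x - x₀)) := by
        rw [hv, inner_neg_left, real_inner_smul_left]
      rw [h6]
      linarith
    · have := min_le_left δ ‖w‖
      linarith

/-- Comparison on a compact cylinder: if `ψ ≤ u` on the parabolic boundary and `u < ψ` somewhere on
the top, then a translate of `ψ` touches `u` from below at an interior point. -/
theorem exists_touching_point
    (hu : LowerSemicontinuousOn u (backwardUnitCylinder n))
    {ψ : SpaceTime n → ℝ} (hψ : Continuous ψ) {S O : Set (EuclideanSpace ℝ (Fin n))}
    (hS : IsCompact S) (hO : IsOpen O) (hOS : O ⊆ S) {t₁ t₀ : ℝ}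
    (hsub : S ×ˢ Icc t₁ t₀ ⊆ backwardUnitCylinder n)
    (hside : ∀ x ∈ S, x ∉ O → ∀ τ ∈ Icc t₁ t₀, ψ (x, τ) ≤ u (x, τ))
    (hinit : ∀ x ∈ S, ψ (x, t₁) ≤ u (x, t₁))
    {x₀ : EuclideanSpace ℝ (Fin n)} (hx₀ : x₀ ∈ S) (ht : t₁ ≤ t₀) (hlt : u (x₀, t₀) < ψ (x₀, t₀)) :
    ∃ x' ∈ O, ∃ t', t₁ < t' ∧ t' ≤ t₀ ∧ (x', t') ∈ backwardUnitCylinder n ∧ ∃ δ > 0,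
      ∀ x τ, ‖x - x'‖ < δ → t' - δ < τ → τ ≤ t' →
        u (x', t') + (ψ (x, τ) - ψ (x', t')) ≤ u (x, τ) := by
  have hK : IsCompact (S ×ˢ Icc t₁ t₀) := hS.prod isCompact_Icc
  have hlsc : LowerSemicontinuousOn (fun z => u z + -ψ z) (S ×ˢ Icc t₁ t₀) :=
    (hu.mono hsub).add (hψ.neg.lowerSemicontinuous.lowerSemicontinuousOn _)
  have hmem : (x₀, t₀) ∈ S ×ˢ Icc t₁ t₀ := ⟨hx₀, ht, le_rfl⟩
  obtain ⟨⟨x', t'⟩, hz', hmin⟩ := hlsc.exists_isMinOn ⟨_, hmem⟩ hK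
  have hneg : u (x', t') + -ψ (x', t') < 0 := by
    have : u (x', t') + -ψ (x', t') ≤ u (x₀, t₀) + -ψ (x₀, t₀) := hmin hmem
    linarith
  have hx' : x' ∈ O := by
    by_contra h
    have := hside x' hz'.1 h t' hz'.2
    linarith
  have ht' : t₁ < t' := by
    refine lt_of_le_of_ne hz'.2.1 fun h => ?_
    have := hinit x' hz'.1
    rw [h] at this
    linarith
  obtain ⟨ε, hε, hball⟩ := Metric.isOpen_iff.1 hO x' hx'
  refine ⟨x', hx', t', ht', hz'.2.2, hsub hz', min ε (t' - t₁), lt_min hε (by linarith), ?_⟩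
  intro x τ hx h1 h2
  have hxS : x ∈ S := hOS (hball (by
    rw [Metric.mem_ball, dist_eq_norm]; exact hx.trans_le (min_le_left _ _)))
  have h3 := min_le_right ε (t' - t₁)
  have : u (x', t') + -ψ (x', t') ≤ u (x, τ) + -ψ (x, τ) :=
    hmin (show (x, τ) ∈ S ×ˢ Icc t₁ t₀ from ⟨hxS, by linarith, h2.trans hz'.2.2⟩)
  linarith

/-- Touching from below by `ν t - A |x - y|^(p/(p-1))` at the vertex bounds `ν` from below. -/
theorem IsViscositySupersolution.vertex_test (hu : IsViscositySupersolution p lam Lam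
      (Metric.ball (0 : EuclideanSpace ℝ (Fin n)) 1) (-1) 0 u) (hn : 1 ≤ n) (hp : 1 < p)
    (hlam : 0 < lam) (hLam : lam ≤ Lam)
    (hu0 : ∀ z ∈ backwardUnitCylinder n, 0 ≤ u z)
    {x₀ : EuclideanSpace ℝ (Fin n)} {t₀ : ℝ} (hz : (x₀, t₀) ∈ backwardUnitCylinder n)
    {A ν δ : ℝ} {k : ℕ} (hk : 2 ≤ k) (hkp : 1 < (2 * k - 1) * (p - 1)) (hA : 0 < A) (hδ : 0 < δ)
    (hloc : ∀ x τ, (x, τ) ∈ backwardUnitCylinder n → ‖x - x₀‖ < δ → t₀ - δ < τ → τ ≤ t₀ →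
      u (x₀, t₀) + ν * (τ - t₀) - A * ‖x - x₀‖ ^ (p / (p - 1)) ≤ u (x, τ)) :
    -(2 * (speedConst n p lam Lam (2 * k) * (2 * A) ^ (p - 1))) ≤ ν := by
  have hk' : (2 : ℝ) ≤ k := by exact_mod_cast hk
  have hm : (1 : ℝ) < 2 * k := by linarith
  have hC := speedConst_nonneg (n := n) (p := p) hlam hLam hm
  by_contra! hν
  have hP : 0 ≤ 2 * (speedConst n p lam Lam (2 * k) * (2 * A) ^ (p - 1)) := by positivity
  have hν0 : ν < 0 := by linarith
  set α := p / (p - 1) with hα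
  have hα0 : 0 < α := div_pos (by linarith) (by linarith)
  have hαp : α * (p - 1) = p := by rw [hα]; field_simp [(by linarith : p - 1 ≠ 0)]
  have hx₀ : ‖x₀‖ < 1 := by simpa using hz.1
  have ht₀ : -1 < t₀ := hz.2.1
  set θ := min (δ / 2) ((t₀ + 1) / 2) with hθ
  have hθ0 : 0 < θ := lt_min (by linarith) (by linarith)
  have hθ1 : θ < δ := (min_le_left _ _).trans_lt (by linarith)
  have hθ2 : -1 < t₀ - θ := by
    have := min_le_right (δ / 2) ((t₀ + 1) / 2)
    linarith
  obtain ⟨R, hR0, hR1, hR2, hR3⟩ : ∃ R > 0, R < δ ∧ ‖x₀‖ + R < 1 ∧ 4 * A * R ^ α ≤ -ν * θ := by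
    have h1 : Tendsto (fun R : ℝ => 4 * A * R ^ α) (𝓝[>] 0) (𝓝 0) := by
      have := ((Real.continuousAt_rpow_const 0 α (Or.inr hα0.le)).tendsto.const_mul
        (4 * A)).mono_left (nhdsWithin_le_nhds (s := Ioi (0 : ℝ)))
      rwa [Real.zero_rpow hα0.ne', mul_zero] at this
    have h2 := h1.eventually (gt_mem_nhds (show 0 < -ν * θ by nlinarith))
    have h3 : ∀ᶠ R in 𝓝[>] (0 : ℝ), R < δ := nhdsWithin_le_nhds (gt_mem_nhds hδ)
    have h4 : ∀ᶠ R in 𝓝[>] (0 : ℝ), R < 1 - ‖x₀‖ := nhdsWithin_le_nhds (gt_mem_nhds (by linarith))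
    obtain ⟨R, ⟨⟨hR2, hR3⟩, hR4⟩, hR0⟩ := (((h2.and h3).and h4).and self_mem_nhdsWithin).exists
    exact ⟨R, hR0, hR3, by linarith, hR2.le⟩
  -- With `B * R ^ (2k) = 2 * A * R ^ α`, the comparison function exceeds `u` by `A * R ^ α` at the
  -- centre and lies below the given minorant on the sphere of radius `R`. Halving the negative
  -- slope `ν` leaves room at the initial time, by `4 * A * R ^ α ≤ -ν * θ`.
  set B := 2 * A * R ^ (α - 2 * k) with hB
  have hB0 : 0 < B := by positivity
  have hBR : B * R ^ (2 * k : ℝ) = 2 * A * R ^ α := by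
    rw [hB, mul_assoc, ← Real.rpow_add hR0]; congr 2; ring
  set ψ : SpaceTime n → ℝ := fun z => u (x₀, t₀) + A * R ^ α + ν / 2 * (z.2 - t₀)
    - B * ‖z.1 - x₀‖ ^ (2 * k : ℝ) with hψ
  have hψc : Continuous ψ := by
    have h1 : Continuous fun z : SpaceTime n => ‖z.1 - x₀‖ ^ (2 * k : ℝ) :=
      (continuous_fst.sub continuous_const).norm.rpow_const fun _ => Or.inr (by linarith)
    fun_prop
  have hsub : Metric.closedBall x₀ R ×ˢ Icc (t₀ - θ) t₀ ⊆ backwardUnitCylinder n := by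
    rintro ⟨x, τ⟩ ⟨hx, hτ⟩
    rw [mem_closedBall_iff_norm] at hx
    refine ⟨?_, by linarith [hτ.1], hτ.2.trans hz.2.2⟩
    rw [mem_ball_zero_iff]
    calc ‖x‖ = ‖x₀ + (x - x₀)‖ := by simp
      _ ≤ ‖x₀‖ + ‖x - x₀‖ := norm_add_le _ _
      _ < 1 := by linarith
  have hlow : ∀ x ∈ Metric.closedBall x₀ R, ∀ τ ∈ Icc (t₀ - θ) t₀,
      u (x₀, t₀) + ν * (τ - t₀) - A * ‖x - x₀‖ ^ α ≤ u (x, τ) := by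
    intro x hx τ hτ
    refine hloc x τ (hsub ⟨hx, hτ⟩) ?_ (by linarith [hτ.1]) hτ.2
    rw [mem_closedBall_iff_norm] at hx
    linarith
  have hxR : ∀ x ∈ Metric.closedBall x₀ R, A * ‖x - x₀‖ ^ α ≤ A * R ^ α := by
    intro x hx
    rw [mem_closedBall_iff_norm] at hx
    gcongr
  have hside : ∀ x ∈ Metric.closedBall x₀ R, x ∉ Metric.ball x₀ R → ∀ τ ∈ Icc (t₀ - θ) t₀,
      ψ (x, τ) ≤ u (x, τ) := by
    intro x hx hxO τ hτ
    refine le_trans ?_ (hlow x hx τ hτ)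
    have hxe : ‖x - x₀‖ = R := by
      rw [mem_closedBall_iff_norm] at hx
      rw [mem_ball_iff_norm] at hxO
      linarith
    have : ν * (τ - t₀) ≥ ν / 2 * (τ - t₀) := by nlinarith [hτ.2]
    simp only [hψ, hxe, hBR]
    linarith
  have hinit : ∀ x ∈ Metric.closedBall x₀ R, ψ (x, t₀ - θ) ≤ u (x, t₀ - θ) := by
    intro x hx
    refine le_trans ?_ (hlow x hx (t₀ - θ) ⟨le_rfl, by linarith⟩)
    have h1 := hxR x hx
    have h2 : 0 ≤ B * ‖x - x₀‖ ^ (2 * k : ℝ) := by positivity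
    simp only [hψ]
    linarith
  have htop : u (x₀, t₀) < ψ (x₀, t₀) := by
    have : (0 : ℝ) ^ (2 * k : ℝ) = 0 := Real.zero_rpow (by linarith)
    simp only [hψ, sub_self, norm_zero, this]
    have : 0 < A * R ^ α := by positivity
    linarith
  obtain ⟨x', hx', t', ht1, ht2, hz', ε, hε, htouch⟩ := exists_touching_point
    hu.lowerSemicontinuousOn hψc
    (isCompact_closedBall x₀ R) Metric.isOpen_ball Metric.ball_subset_closedBall hsub
    hside hinit (Metric.mem_closedBall_self hR0.le) (by linarith) htop
  rcases eq_or_ne x' x₀ with rfl | hne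
  · have := hu.critical_test hn hlam hLam hu0 hz' (B := B) (ν := ν / 2) hk hkp hε ?_
    · linarith
    · intro x τ _ h1 h2 h3
      refine le_trans (le_of_eq ?_) (htouch x τ h1 h2 h3)
      have : (0 : ℝ) ^ (2 * k : ℝ) = 0 := Real.zero_rpow (by linarith)
      have e1 : ‖x - x'‖ ^ (2 * k : ℝ) = (‖x - x'‖ ^ 2) ^ k := by
        rw [← pow_mul, ← Real.rpow_natCast]; push_cast; rfl
      simp only [hψ, sub_self, norm_zero, this, e1]
      ring
  · have hw : x' - x₀ ≠ 0 := sub_ne_zero.2 hne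
    have h1 := hu.power_test hn hlam hLam hu0 hz' hw (q := 2 * k) (B := B) (ν := ν / 2) hm hB0 hε ?_
    · have hw0 : 0 < ‖x' - x₀‖ := norm_pos_iff.2 hw
      have hwR : ‖x' - x₀‖ ≤ R := by
        rw [mem_ball_iff_norm] at hx'
        exact hx'.le
      -- The speed exponent is nonnegative by `hkp`, so the worst distance is `R`; there the powers
      -- of `R` cancel and leave a bound depending only on `A`.
      have hex : 0 ≤ 2 * k * (p - 1) - p := by linarith
      have h2 : ‖x' - x₀‖ ^ (2 * k * (p - 1) - p) ≤ R ^ (2 * k * (p - 1) - p) :=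
        Real.rpow_le_rpow hw0.le hwR hex
      have h3 : B ^ (p - 1) * R ^ (2 * k * (p - 1) - p) = (2 * A) ^ (p - 1) := by
        rw [hB, Real.mul_rpow (by positivity) (by positivity), ← Real.rpow_mul hR0.le, mul_assoc,
          ← Real.rpow_add hR0]
        have : (α - 2 * k) * (p - 1) + (2 * k * (p - 1) - p) = 0 := by rw [sub_mul, hαp]; ring
        rw [this, Real.rpow_zero, mul_one]
      have h4 := mul_le_mul_of_nonneg_left h2
        (by positivity : 0 ≤ speedConst n p lam Lam (2 * k) * B ^ (p - 1))
      rw [mul_assoc _ _ (R ^ _), h3] at h4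
      linarith
    · intro x τ _ h1 h2 h3
      refine le_trans (le_of_eq ?_) (htouch x τ h1 h2 h3)
      have : x' - x₀ + (x - x') = x - x₀ := by abel
      simp only [hψ, this]
      ring

/-- A bound for the speed at which the contact level of the sliding profiles decreases. -/
def decayConst (n : ℕ) (p lam Lam A : ℝ) (k : ℕ) : ℝ :=
  9 + speedConst n p lam Lam (p / (p - 1)) * A ^ (p - 1)
    + 2 * (speedConst n p lam Lam (2 * k) * (2 * A) ^ (p - 1))

theorem decayConst_pos (hp : 1 < p) (hlam : 0 < lam) (hLam : lam ≤ Lam) {A : ℝ} (hA : 0 < A)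
    {k : ℕ} (hk : 2 ≤ k) : 0 < decayConst n p lam Lam A k := by
  have hk' : (2 : ℝ) ≤ k := by exact_mod_cast hk
  have h1 := speedConst_nonneg (n := n) (p := p) (q := 2 * k) hlam hLam (by linarith)
  have h2 := speedConst_nonneg (n := n) (p := p) (q := p / (p - 1)) hlam hLam
    (by rw [lt_div_iff₀ (by linarith)]; linarith)
  unfold decayConst
  positivity

/-- The level at which `8 t - A |x - y|^(p/(p-1))`, translated, meets `u` at `(x, t)`. -/
def contactLevel (p A : ℝ) (u : SpaceTime n → ℝ) (y : EuclideanSpace ℝ (Fin n))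
    (z : SpaceTime n) : ℝ :=
  u z - 8 * z.2 + A * ‖z.1 - y‖ ^ (p / (p - 1))

theorem four_le_of_half_le_norm (hp : 1 < p) {A : ℝ} (hA : 0 < A)
    (hA4 : 4 ≤ A * (1 / 4) ^ (p / (p - 1))) {x y : EuclideanSpace ℝ (Fin n)} (hy : ‖y‖ ≤ 1 / 4)
    (hx : 1 / 2 ≤ ‖x‖) : 4 ≤ A * ‖x - y‖ ^ (p / (p - 1)) := by
  refine hA4.trans ?_
  have : 1 / 4 ≤ ‖x - y‖ := by linarith [norm_sub_norm_le x y]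
  have : 0 < p / (p - 1) := div_pos (by linarith) (by linarith)
  gcongr

/-- If the level fell faster, the profile descending at relative speed `L` would touch `u` from
below. The touching point has `‖x‖ < 1/2`, since the profile is at most `u` farther out by `hA4` and
`hh`. Both away from and at the vertex, `L` exceeds the admissible speed; the 9 in `decayConst`
beats the slope 8 strictly. -/
theorem IsViscositySupersolution.contactLevel_decay (hu : IsViscositySupersolution p lam Lam
      (Metric.ball (0 : EuclideanSpace ℝ (Fin n)) 1) (-1) 0 u) (hn : 1 ≤ n) (hp : 1 < p)
    (hlam : 0 < lam) (hLam : lam ≤ Lam)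
    (hu0 : ∀ z ∈ backwardUnitCylinder n, 0 ≤ u z)
    {A : ℝ} {k : ℕ} (hk : 2 ≤ k) (hkp : 1 < (2 * k - 1) * (p - 1)) (hA : 0 < A)
    (hA4 : 4 ≤ A * (1 / 4) ^ (p / (p - 1)))
    {y : EuclideanSpace ℝ (Fin n)} (hy : ‖y‖ ≤ 1 / 4) {t h : ℝ} (ht : -1 < t) (hh : h ≤ 3)
    (hpast : ∀ z ∈ backwardUnitCylinder n, z.2 ≤ t → h ≤ contactLevel p A u y z)
    {z : SpaceTime n} (hz : z ∈ backwardUnitCylinder n) (hzt : t ≤ z.2) :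
    h - decayConst n p lam Lam A k * (z.2 - t) ≤ contactLevel p A u y z := by
  have hk' : (2 : ℝ) ≤ k := by exact_mod_cast hk
  set L := decayConst n p lam Lam A k with hL
  have hL0 : 0 < L := decayConst_pos hp hlam hLam hA hk
  have hα1 : 1 < p / (p - 1) := by rw [lt_div_iff₀ (by linarith)]; linarith
  have hαp : p / (p - 1) * (p - 1) - p = 0 := by field_simp [(by linarith : p - 1 ≠ 0)]; ring
  have hs1 := speedConst_nonneg (n := n) (p := p) (q := 2 * k) hlam hLam (by linarith)
  have hs2 := speedConst_nonneg (n := n) (p := p) (q := p / (p - 1)) hlam hLam hα1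
  obtain ⟨x₀, t₀⟩ := z
  have hzt : t ≤ t₀ := hzt
  by_contra! hlt
  simp only [contactLevel] at hlt hpast
  set α := p / (p - 1) with hα
  have ht₀ : t₀ ≤ 0 := hz.2.2
  have hx₀ : ‖x₀‖ ≤ 1 / 2 := by
    by_contra! hx
    have h1 := four_le_of_half_le_norm hp hA hA4 hy hx.le
    have h2 := hu0 _ hz
    have : 0 ≤ L * (t₀ - t) := mul_nonneg hL0.le (by linarith)
    linarith
  set ψ : SpaceTime n → ℝ := fun z => h + 8 * z.2 - A * ‖z.1 - y‖ ^ α - L * (z.2 - t) with hψ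
  have hψc : Continuous ψ := by
    have h1 : Continuous fun z : SpaceTime n => ‖z.1 - y‖ ^ α :=
      (continuous_fst.sub continuous_const).norm.rpow_const fun _ => Or.inr (by linarith)
    fun_prop
  have hsub : Metric.closedBall 0 (1 / 2) ×ˢ Icc t t₀ ⊆ backwardUnitCylinder n := by
    rintro ⟨x, τ⟩ ⟨hx, hτ⟩
    rw [mem_closedBall_zero_iff] at hx
    refine ⟨?_, ht.trans_le hτ.1, hτ.2.trans ht₀⟩
    rw [mem_ball_zero_iff]
    linarith
  have hside : ∀ x ∈ Metric.closedBall (0 : EuclideanSpace ℝ (Fin n)) (1 / 2),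
      x ∉ Metric.ball 0 (1 / 2) → ∀ τ ∈ Icc t t₀, ψ (x, τ) ≤ u (x, τ) := by
    intro x hx hxO τ hτ
    rw [mem_ball_zero_iff] at hxO
    have h1 := four_le_of_half_le_norm hp hA hA4 hy (not_lt.1 hxO)
    have h2 := hu0 (x, τ) (hsub ⟨hx, hτ⟩)
    have : 0 ≤ L * (τ - t) := mul_nonneg hL0.le (by linarith [hτ.1])
    simp only [hψ]
    linarith [hτ.2]
  have hinit : ∀ x ∈ Metric.closedBall (0 : EuclideanSpace ℝ (Fin n)) (1 / 2),
      ψ (x, t) ≤ u (x, t) := by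
    intro x hx
    have := hpast (x, t) (hsub ⟨hx, le_rfl, hzt⟩) le_rfl
    simp only [hψ] at this ⊢
    linarith
  obtain ⟨x', hx', t', ht1, ht2, hz', ε, hε, htouch⟩ := exists_touching_point
    hu.lowerSemicontinuousOn hψc
    (isCompact_closedBall 0 (1 / 2)) Metric.isOpen_ball Metric.ball_subset_closedBall hsub
    hside hinit (x₀ := x₀) (by simpa using hx₀) hzt (by simp only [hψ]; linarith)
  rcases eq_or_ne x' y with rfl | hne
  · have := hu.vertex_test hn hp hlam hLam hu0 hz' (A := A) (ν := 8 - L) hk hkp hA hε ?_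
    · have h1 : 0 ≤ speedConst n p lam Lam α * A ^ (p - 1) := by positivity
      rw [hL, decayConst] at this
      linarith
    · intro x τ _ h1 h2 h3
      refine le_trans (le_of_eq ?_) (htouch x τ h1 h2 h3)
      have : (0 : ℝ) ^ α = 0 := Real.zero_rpow (by linarith)
      simp only [hψ, sub_self, norm_zero, this]
      ring
  · have := hu.power_test hn hlam hLam hu0 hz' (sub_ne_zero.2 hne) (q := α) (B := A) (ν := 8 - L)
      hα1 hA hε ?_
    · have h1 : 0 ≤ 2 * (speedConst n p lam Lam (2 * k) * (2 * A) ^ (p - 1)) := by positivity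
      -- For `q = α` the power of the distance to the vertex is zero, so the bound is uniform.
      rw [hL, decayConst, hαp, Real.rpow_zero, mul_one] at this
      linarith
    · intro x τ _ h1 h2 h3
      refine le_trans (le_of_eq ?_) (htouch x τ h1 h2 h3)
      have : x' - y + (x - x') = x - y := by abel
      simp only [hψ, this]
      ring

end Decay


/-! ### Exclusion of convex kinks -/

section Kink

variable {n : ℕ} {p lam Lam : ℝ} {u : SpaceTime n → ℝ}

set_option maxHeartbeats 1000000 in
/-- A supersolution cannot have a convex kink in the past of a point where its gradient is large,
at a scale `R` at which the kink dominates all other terms. -/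
theorem IsViscositySupersolution.no_kink (hu : IsViscositySupersolution p lam Lam
      (Metric.ball (0 : EuclideanSpace ℝ (Fin n)) 1) (-1) 0 u)
    (hlam : 0 < lam) (hLam : lam ≤ Lam)
    (hu0 : ∀ z ∈ backwardUnitCylinder n, 0 ≤ u z)
    {x₀ v e : EuclideanSpace ℝ (Fin n)} {t₀ R θ s₀ κ a b E : ℝ} (he : ‖e‖ = 1)
    (hR : 0 < R) (hθ : 0 < θ) (hs0 : 0 < s₀) (hs1 : s₀ ≤ 1)
    (hsP : 1 ≤ 2 * lam * (1 / (4 * s₀)) - (2 * lam + 2 * Lam * n) * (s₀ / 2))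
    (hκ : 0 < κ) (hκv : 4 * κ ≤ ‖v‖) (hE : 4 * E < κ * R * s₀)
    (hsub : Metric.closedBall x₀ R ×ˢ Icc (t₀ - θ) t₀ ⊆ backwardUnitCylinder n)
    (hlow : ∀ x ∈ Metric.closedBall x₀ R, ∀ τ ∈ Icc (t₀ - θ) t₀,
      a + b * (τ - t₀) + inner ℝ v (x - x₀) + max 0 (κ * inner ℝ e (x - x₀)) - E ≤ u (x, τ))
    (hua : u (x₀, t₀) ≤ a)
    (hbig : b + κ * R * s₀ / θ < (2 ^ |p - 2|)⁻¹ * ‖v‖ ^ (p - 2) * (κ / R)) : False := by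
  -- The extra time slope lowers the comparison function at time `t₀ - θ` by `κ * R * s₀`, the
  -- largest value of the convex term `m * (g + s₀ * R) ^ 2` on the slab `|g| ≤ s₀ * R`.
  set N := κ * R * s₀ / θ with hN
  have hN0 : 0 < N := by positivity
  have hNθ : N * θ = κ * R * s₀ := by rw [hN]; field_simp
  -- This opening makes `m * (g + s₀ * R) ^ 2` agree with the kink `max 0 (κ * g)` at `g = ± s₀ *
  -- R`. In between it is larger, by `κ * R * s₀ / 4 > E` at `g = 0`.
  set m := κ / (4 * s₀ * R) with hm
  have hm0 : 0 < m := by positivity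
  have hmR : m * (s₀ * R) = κ / 4 := by rw [hm]; field_simp
  -- Then `σ * R ^ 2` is twice that surplus, which pushes the comparison function below the kink on
  -- the sphere of radius `R`.
  set σ := κ * s₀ / (2 * R) with hσ
  have hσ0 : 0 < σ := by positivity
  have hσR : σ * R ^ 2 = κ * (s₀ * R) / 2 := by rw [hσ]; field_simp
  have hσR1 : σ * R = κ * s₀ / 2 := by rw [hσ]; field_simp
  have hsR : 0 < s₀ * R := by positivity
  set ψ : SpaceTime n → ℝ := fun z => a - E + b * (z.2 - t₀) + inner ℝ v (z.1 - x₀)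
    + (m * (inner ℝ e (z.1 - x₀) + s₀ * R) ^ 2 - σ * ‖z.1 - x₀‖ ^ 2) + N * (z.2 - t₀) with hψ
  have hψc : Continuous ψ := by fun_prop
  set S : Set (EuclideanSpace ℝ (Fin n)) :=
    Metric.closedBall x₀ R ∩ {x | |inner ℝ e (x - x₀)| ≤ s₀ * R} with hS
  set O : Set (EuclideanSpace ℝ (Fin n)) :=
    Metric.ball x₀ R ∩ {x | |inner ℝ e (x - x₀)| < s₀ * R} with hO
  have hgc : Continuous fun x : EuclideanSpace ℝ (Fin n) => |(inner ℝ e (x - x₀) : ℝ)| := by fun_prop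
  have hSc : IsCompact S := (isCompact_closedBall x₀ R).inter_right (isClosed_le hgc continuous_const)
  have hOo : IsOpen O := Metric.isOpen_ball.inter (isOpen_lt hgc continuous_const)
  have hOS : O ⊆ S :=
    inter_subset_inter Metric.ball_subset_closedBall fun x (hx : |inner ℝ e (x - x₀)| < s₀ * R) => hx.le
  have hside : ∀ x ∈ S, x ∉ O → ∀ τ ∈ Icc (t₀ - θ) t₀, ψ (x, τ) ≤ u (x, τ) := by
    intro x hx hxO τ hτ
    refine le_trans ?_ (hlow x hx.1 τ hτ)
    have hxR := mem_closedBall_iff_norm.1 hx.1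
    have hg : |inner ℝ e (x - x₀)| ≤ s₀ * R := hx.2
    have hNt : N * (τ - t₀) ≤ 0 := mul_nonpos_of_nonneg_of_nonpos hN0.le (by linarith [hτ.2])
    set g : ℝ := inner ℝ e (x - x₀) with hg'
    have hq : m * (g + s₀ * R) ^ 2 - σ * ‖x - x₀‖ ^ 2 ≤ max 0 (κ * g) := by
      obtain ⟨hg1, hg2⟩ := abs_le.1 hg
      have hid : m * (g + s₀ * R) ^ 2 = m * (g - s₀ * R) ^ 2 + κ * g := by
        linear_combination 4 * g * hmR
      have hsq0 : 0 ≤ σ * ‖x - x₀‖ ^ 2 := by positivity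
      by_cases hgl : |g| < s₀ * R
      · have hxe : ‖x - x₀‖ = R := by
          by_contra hne
          exact hxO ⟨mem_ball_iff_norm.2 (lt_of_le_of_ne hxR hne), hgl⟩
        rw [hxe, hσR]
        have hm2 : m * (s₀ * R) ^ 2 = κ * (s₀ * R) / 4 := by rw [sq, ← mul_assoc, hmR]; ring
        have hκs : 0 < κ * (s₀ * R) := by positivity
        rcases le_total g 0 with h | h
        · refine le_trans ?_ (le_max_left _ _)
          have : m * (g + s₀ * R) ^ 2 ≤ m * (s₀ * R) ^ 2 :=
            mul_le_mul_of_nonneg_left (by nlinarith) hm0.le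
          linarith
        · refine le_trans ?_ (le_max_right _ _)
          have : m * (g - s₀ * R) ^ 2 ≤ m * (s₀ * R) ^ 2 :=
            mul_le_mul_of_nonneg_left (by nlinarith) hm0.le
          linarith
      · have hge : |g| = s₀ * R := le_antisymm hg (not_lt.1 hgl)
        rcases abs_choice g with h | h
        · refine le_trans ?_ (le_max_right _ _)
          have : g - s₀ * R = 0 := by linarith
          rw [this] at hid
          linarith
        · refine le_trans ?_ (le_max_left _ _)
          have : g + s₀ * R = 0 := by linarith
          rw [this]
          linarith
    simp only [hψ]
    linarith
  have hinit : ∀ x ∈ S, ψ (x, t₀ - θ) ≤ u (x, t₀ - θ) := by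
    intro x hx
    refine le_trans ?_ (hlow x hx.1 (t₀ - θ) ⟨le_rfl, by linarith⟩)
    have hg : |inner ℝ e (x - x₀)| ≤ s₀ * R := hx.2
    set g : ℝ := inner ℝ e (x - x₀) with hg'
    obtain ⟨hg1, hg2⟩ := abs_le.1 hg
    have h1 : m * (g + s₀ * R) ^ 2 ≤ m * (2 * (s₀ * R)) ^ 2 :=
      mul_le_mul_of_nonneg_left (by nlinarith) hm0.le
    have h2 : m * (2 * (s₀ * R)) ^ 2 = κ * R * s₀ := by
      linear_combination 4 * (s₀ * R) * hmR
    have h3 : 0 ≤ σ * ‖x - x₀‖ ^ 2 := by positivity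
    have h4 := le_max_left 0 (κ * g)
    simp only [hψ]
    linarith
  have htop : u (x₀, t₀) < ψ (x₀, t₀) := by
    have h1 : m * (s₀ * R) ^ 2 = κ * R * s₀ / 4 := by rw [sq, ← mul_assoc, hmR]; ring
    simp only [hψ, sub_self, inner_zero_right, norm_zero, zero_add, h1]
    linarith
  obtain ⟨x', hx', t', ht1, ht2, hz', ε, hε, htouch⟩ := exists_touching_point
    hu.lowerSemicontinuousOn hψc hSc hOo hOS
    ((prod_mono inter_subset_left subset_rfl).trans hsub) hside hinit
    (show x₀ ∈ S from ⟨Metric.mem_closedBall_self hR.le, by simpa using hsR.le⟩) (by linarith) htop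
  have hx'R : ‖x' - x₀‖ ≤ R := (mem_ball_iff_norm.1 hx'.1).le
  have hg : |inner ℝ e (x' - x₀)| < s₀ * R := hx'.2
  set g : ℝ := inner ℝ e (x' - x₀) with hg'
  obtain ⟨hg1, hg2⟩ := abs_lt.1 hg
  -- The gradient of the comparison function at the touching point; it differs from `v` by at most
  -- `2 * κ ≤ ‖v‖ / 2`, so its norm is comparable to `‖v‖`.
  set V := v + ((2 * m * (g + s₀ * R)) • e - (2 * σ) • (x' - x₀)) with hV
  have hVv : ‖(2 * m * (g + s₀ * R)) • e - (2 * σ) • (x' - x₀)‖ ≤ 2 * κ := by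
    refine (norm_sub_le _ _).trans ?_
    rw [norm_smul, norm_smul, he, Real.norm_of_nonneg (mul_nonneg (by positivity) (by linarith)),
      Real.norm_of_nonneg (by positivity)]
    have h1 : m * (g + s₀ * R) ≤ m * (2 * (s₀ * R)) := by
      exact mul_le_mul_of_nonneg_left (by linarith) hm0.le
    have h2 : σ * ‖x' - x₀‖ ≤ σ * R := mul_le_mul_of_nonneg_left hx'R hσ0.le
    have h3 : κ * s₀ ≤ κ * 1 := mul_le_mul_of_nonneg_left hs1 hκ.le
    linarith
  have hV1 : ‖v‖ / 2 ≤ ‖V‖ := by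
    have : ‖v‖ - ‖(2 * m * (g + s₀ * R)) • e - (2 * σ) • (x' - x₀)‖ ≤ ‖V‖ := by
      rw [hV]; exact norm_sub_le_norm_add _ _
    linarith
  have hV2 : ‖V‖ ≤ 2 * ‖v‖ := (norm_add_le _ _).trans (by linarith)
  have hV0 : 0 < ‖V‖ := by linarith
  have h := hu.quadratic_test hlam hLam hu0 hz' he (v := V) (s := m) (σ := σ) (B := 0)
    (ν := b + N) (k := 2) hm0.le hσ0.le le_rfl hε (Or.inr (norm_pos_iff.1 hV0)) ?_
  · have h1 := rpow_le_of_comparable (a := p - 2) hV0 (M := ‖v‖) (by linarith) (by linarith)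
    have h2 : κ / R * 1 ≤ 2 * lam * m - (2 * lam + 2 * Lam * n) * σ := by
      refine (mul_le_mul_of_nonneg_left hsP (by positivity)).trans (le_of_eq ?_)
      rw [hm, hσ]
      field_simp
    have h3 : (2 ^ |p - 2|)⁻¹ * ‖v‖ ^ (p - 2) ≤ ‖V‖ ^ (p - 2) := by
      rw [inv_mul_le_iff₀ (by positivity)]; exact h1
    have h4 : (2 ^ |p - 2|)⁻¹ * ‖v‖ ^ (p - 2) * (κ / R)
        ≤ ‖V‖ ^ (p - 2) * (2 * lam * m - (2 * lam + 2 * Lam * n) * σ) :=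
      mul_le_mul h3 (by linarith) (by positivity) (by positivity)
    linarith
  · intro x τ _ h1 h2 h3
    refine le_trans (le_of_eq ?_) (htouch x τ h1 h2 h3)
    have e1 : x - x₀ = (x' - x₀) + (x - x') := by abel
    simp only [hψ, hV]
    rw [e1, norm_add_sq_real]
    simp only [inner_add_right, inner_add_left, inner_sub_left, real_inner_smul_left]
    rw [← hg']
    simp only [inner_sub_right] at hg' ⊢
    ring

end Kink


/-! ### Slope jumps between simultaneous contacts -/

section ContactMap

theorem rpow_norm_add_le_of_two_le {F : Type*} [NormedAddCommGroup F] [InnerProductSpace ℝ F]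
    {q d : ℝ} (hq : 2 ≤ q) (hd : 0 < d) {w z : F} (hw : ‖w‖ ≤ d) (hz : ‖z‖ ≤ d) :
    ‖w + z‖ ^ q ≤ ‖w‖ ^ q + q * inner ℝ (powVec q w) z
      + powConst q * d ^ (q - 2) * ‖z‖ ^ 2 := by
  refine (rpow_norm_add_le (by linarith) w z).trans ?_
  have h3 : max ‖w + z‖ ‖w‖ ≤ 2 * d :=
    max_le ((norm_add_le _ _).trans (by linarith)) (by linarith)
  have h4 : max ‖w + z‖ ‖w‖ ^ (q - 2) ≤ (2 * d) ^ (q - 2) :=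
    Real.rpow_le_rpow (le_max_of_le_right (norm_nonneg _)) h3 (by linarith)
  rw [Real.mul_rpow (by norm_num) hd.le] at h4
  have h5 := mul_le_mul_of_nonneg_left h4
    (by have : 0 < q := by linarith
        positivity : 0 ≤ q * (q + 2) * ‖z‖ ^ 2)
  unfold powConst
  rw [abs_of_nonneg (by linarith : 0 ≤ q - 2)]
  linarith

/-- The negative power of `max ‖w + z‖ ‖w‖` is harmless because that maximum is at least `‖z‖ / 2`.
The bound is uniform in `w`, so it also covers expansions close to the vertex. -/
theorem rpow_norm_add_le_of_le_two {F : Type*} [NormedAddCommGroup F] [InnerProductSpace ℝ F]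
    {q : ℝ} (hq : 1 < q) (hq2 : q ≤ 2) (w z : F) :
    ‖w + z‖ ^ q ≤ ‖w‖ ^ q + q * inner ℝ (powVec q w) z + powConst q * ‖z‖ ^ q := by
  refine (rpow_norm_add_le hq w z).trans ?_
  rcases eq_or_ne z 0 with rfl | hz
  · simp [Real.zero_rpow (by linarith : q ≠ 0)]
  have hz0 : 0 < ‖z‖ := norm_pos_iff.2 hz
  have h3 : ‖z‖ / 2 ≤ max ‖w + z‖ ‖w‖ := by
    have h1 : ‖z‖ ≤ ‖w + z‖ + ‖w‖ := by
      have := norm_sub_le (w + z) w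
      rwa [add_sub_cancel_left] at this
    have h2 := le_max_left ‖w + z‖ ‖w‖
    have h3 := le_max_right ‖w + z‖ ‖w‖
    linarith
  have h4 : max ‖w + z‖ ‖w‖ ^ (q - 2) ≤ (‖z‖ / 2) ^ (q - 2) :=
    Real.rpow_le_rpow_of_nonpos (by positivity) h3 (by linarith)
  have h5 : (‖z‖ / 2) ^ (q - 2) * ‖z‖ ^ 2 = 2 ^ |q - 2| * ‖z‖ ^ q := by
    rw [abs_of_nonpos (by linarith), Real.rpow_neg (by norm_num), ← Real.inv_rpow (by norm_num),
      div_eq_inv_mul, Real.mul_rpow (by norm_num) hz0.le, mul_assoc, ← Real.rpow_two,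
      ← Real.rpow_add hz0]
    congr 2; ring
  have h6 := mul_le_mul_of_nonneg_left h4
    (by have : 0 < q := by linarith
        positivity : 0 ≤ q * (q + 2) * ‖z‖ ^ 2)
  have h7 : q * (q + 2) * ‖z‖ ^ 2 * (‖z‖ / 2) ^ (q - 2) = q * (q + 2) * 2 ^ |q - 2| * ‖z‖ ^ q := by
    linear_combination q * (q + 2) * h5
  unfold powConst
  linarith

variable {n : ℕ} {p lam Lam : ℝ} {u : SpaceTime n → ℝ}

/-- `c` is a small constant for the scale at which kinks are compared. -/
structure IsKinkScale (p A s₀ c : ℝ) : Prop where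
  pos : 0 < c
  le_one : c * (A * (p / (p - 1))) ≤ 1
  quadratic : 64 * (A * powConst (p / (p - 1))) * c ≤ s₀
  power : p / (p - 1) < 2 → 4 * (A * powConst (p / (p - 1))) *
    (c * (A * (p / (p - 1)))) ^ (p / (p - 1) - 1)
      ≤ s₀ / 16 * (min (1 - (1 / 2) ^ (p / (p - 1) - 1)) (1 / 4) * (A * (p / (p - 1))))
  speed : c * (8 + A * (p / (p - 1))) < (2 ^ |p - 2|)⁻¹ * (A * (p / (p - 1))) ^ (p - 2)

theorem one_lt_conj (hp : 1 < p) : 1 < p / (p - 1) := by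
  rw [lt_div_iff₀ (by linarith)]; linarith

/-- Every condition holds for small `c`: the side containing `c` tends to 0 while the other is a
fixed positive number. -/
theorem exists_isKinkScale (hp : 1 < p) {A s₀ : ℝ} (hA : 0 < A) (hs₀ : 0 < s₀) :
    ∃ c, IsKinkScale p A s₀ c := by
  have hα := one_lt_conj hp
  set α := p / (p - 1) with hαd
  have hP := powConst_pos hα
  set V := A * α with hV
  have hV0 : 0 < V := mul_pos hA (by linarith)
  have hlin : ∀ a : ℝ, Tendsto (fun c : ℝ => a * c) (𝓝[>] 0) (𝓝 0) := fun a => by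
    have : Tendsto (fun c : ℝ => a * c) (𝓝 0) (𝓝 (a * 0)) := (continuous_const_mul a).tendsto 0
    rw [mul_zero] at this
    exact this.mono_left nhdsWithin_le_nhds
  have h1 := (hlin V).eventually (gt_mem_nhds one_pos)
  have h2 := (hlin (64 * (A * powConst α))).eventually (gt_mem_nhds hs₀)
  have h4 := (hlin (8 + V)).eventually
    (gt_mem_nhds (by positivity : 0 < (2 ^ |p - 2|)⁻¹ * V ^ (p - 2)))
  have hhalf : (1 / 2 : ℝ) ^ (α - 1) < 1 :=
    Real.rpow_lt_one (by norm_num) (by norm_num) (by linarith)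
  have hmin : 0 < min (1 - (1 / 2 : ℝ) ^ (α - 1)) (1 / 4) := lt_min (by linarith) (by norm_num)
  have h3 : ∀ᶠ c in 𝓝[>] (0 : ℝ), 4 * (A * powConst α) * (V * c) ^ (α - 1)
      < s₀ / 16 * (min (1 - (1 / 2) ^ (α - 1)) (1 / 4) * V) := by
    have := ((hlin V).rpow_const (p := α - 1) (Or.inr (by linarith))).const_mul
      (4 * (A * powConst α))
    rw [Real.zero_rpow (by linarith), mul_zero] at this
    exact this.eventually (gt_mem_nhds (by positivity))
  obtain ⟨c, ⟨⟨⟨⟨h1, h2⟩, h3⟩, h4⟩, h0⟩⟩ :=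
    ((((h1.and h2).and h3).and h4).and self_mem_nhdsWithin).exists
  refine ⟨c, h0, ?_, h2.le, fun _ => ?_, ?_⟩
  · rw [mul_comm]; exact h1.le
  · rw [mul_comm c]; exact h3.le
  · rw [mul_comm c]; exact h4

theorem exists_kink_width (hlam : 0 < lam) (hLam : lam ≤ Lam) : ∃ s₀ : ℝ, 0 < s₀ ∧ s₀ ≤ 1 ∧
    1 ≤ 2 * lam * (1 / (4 * s₀)) - (2 * lam + 2 * Lam * n) * (s₀ / 2) := by
  have hLam0 : 0 < Lam := hlam.trans_le hLam
  have hD : 0 < lam + Lam * n := by positivity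
  refine ⟨min 1 (min (lam / 4) (1 / (lam + Lam * n))), by positivity, min_le_left _ _, ?_⟩
  set s := min 1 (min (lam / 4) (1 / (lam + Lam * n))) with hs
  have hs0 : 0 < s := by positivity
  have h1 : s ≤ lam / 4 := (min_le_right _ _).trans (min_le_left _ _)
  have h2 : s ≤ 1 / (lam + Lam * n) := (min_le_right _ _).trans (min_le_right _ _)
  rw [le_div_iff₀ hD] at h2
  have h3 : 2 ≤ 2 * lam * (1 / (4 * s)) := by
    rw [mul_one_div, le_div_iff₀ (by positivity)]
    linarith
  linarith

/-- The gradient at `w` of `-A |w|^(p/(p-1))`. -/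
def profileGradient (p A : ℝ) (w : EuclideanSpace ℝ (Fin n)) : EuclideanSpace ℝ (Fin n) :=
  -((A * (p / (p - 1))) • powVec (p / (p - 1)) w)

theorem norm_profileGradient (hp : 1 < p) {A : ℝ} (hA : 0 < A) (w : EuclideanSpace ℝ (Fin n)) :
    ‖profileGradient p A w‖ = A * (p / (p - 1)) * ‖w‖ ^ (p / (p - 1) - 1) := by
  have := one_lt_conj hp
  have : 0 < A * (p / (p - 1)) := mul_pos hA (by linarith)
  rw [profileGradient, norm_neg, norm_smul, norm_powVec (by assumption), Real.norm_of_nonneg this.le]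

theorem inner_profileGradient {A : ℝ} (w z : EuclideanSpace ℝ (Fin n)) :
    inner ℝ (profileGradient p A w) z = -(A * (p / (p - 1) * inner ℝ (powVec (p / (p - 1)) w) z)) := by
  rw [profileGradient, inner_neg_left, real_inner_smul_left, mul_assoc]

set_option maxHeartbeats 2000000 in
/-- If the profiles with vertices `y₀`, `y₁` are in contact with `u` at `x₀`, `x₁` at the same time,
then the jump of their slopes is bounded by `|x₀ - x₁|`. -/
theorem IsViscositySupersolution.kink_le (hu : IsViscositySupersolution p lam Lam
      (Metric.ball (0 : EuclideanSpace ℝ (Fin n)) 1) (-1) 0 u) (hp : 1 < p)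
    (hlam : 0 < lam) (hLam : lam ≤ Lam)
    (hu0 : ∀ z ∈ backwardUnitCylinder n, 0 ≤ u z)
    {A s₀ c : ℝ} (hA : 0 < A) (hs0 : 0 < s₀) (hs1 : s₀ ≤ 1)
    (hsP : 1 ≤ 2 * lam * (1 / (4 * s₀)) - (2 * lam + 2 * Lam * n) * (s₀ / 2))
    (hc : IsKinkScale p A s₀ c) {x₀ x₁ y₀ y₁ : EuclideanSpace ℝ (Fin n)} {t h₀ h₁ : ℝ}
    (hx₀ : ‖x₀‖ ≤ 1 / 2) (hy₀ : ‖y₀‖ ≤ 1 / 4)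
    (ht : t ∈ Icc (-(1 / 2) : ℝ) 0)
    (hle₀ : contactLevel p A u y₀ (x₀, t) ≤ h₀)
    (hpast₀ : ∀ z ∈ backwardUnitCylinder n, z.2 ≤ t → h₀ ≤ contactLevel p A u y₀ z)
    (hle₁ : contactLevel p A u y₁ (x₁, t) ≤ h₁)
    (hpast₁ : ∀ z ∈ backwardUnitCylinder n, z.2 ≤ t → h₁ ≤ contactLevel p A u y₁ z)
    (hd : x₀ - y₀ ≠ 0) (hd₁ : ‖x₁ - y₁‖ ≤ ‖x₀ - y₀‖) :
    c * min ‖profileGradient p A (x₁ - y₁) - profileGradient p A (x₀ - y₀)‖ (‖profileGradient p A (x₀ - y₀)‖ / 4)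
      * ‖x₀ - y₀‖ ^ (2 - p / (p - 1)) * s₀ ≤ 8 * ‖x₀ - x₁‖ := by
  have hα := one_lt_conj hp
  have hαp : (p / (p - 1) - 1) * (p - 2) = 2 - p / (p - 1) := by
    field_simp [(by linarith : p - 1 ≠ 0)]; ring
  obtain ⟨hc0, hc1, hc2, hc3, hc4⟩ := hc
  have hv0n := norm_profileGradient hp hA (x₀ - y₀)
  have hv1n := norm_profileGradient hp hA (x₁ - y₁)
  have hin0 := inner_profileGradient (p := p) (A := A) (x₀ - y₀)
  have hin1 := inner_profileGradient (p := p) (A := A) (x₁ - y₁)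
  simp only [contactLevel] at hle₀ hpast₀ hle₁ hpast₁
  generalize profileGradient p A (x₀ - y₀) = v₀ at *
  generalize profileGradient p A (x₁ - y₁) = v₁ at *
  generalize p / (p - 1) = α at *
  have hP := powConst_pos hα
  have hV0 : 0 < A * α := mul_pos hA (by linarith)
  obtain ⟨d, hdd⟩ : ∃ d, d = ‖x₀ - y₀‖ := ⟨_, rfl⟩
  have hd0 : 0 < d := by rw [hdd]; exact norm_pos_iff.2 hd
  have hd34 : d ≤ 3 / 4 := by rw [hdd]; exact (norm_sub_le _ _).trans (by linarith)
  rw [← hdd] at hd₁ hv0n ⊢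
  have hAP : 0 < A * powConst α := mul_pos hA hP
  by_contra! hlt
  -- The jump is truncated at `‖v₀‖ / 4` so that the kink is a small perturbation of the slope `v₀`.
  obtain ⟨κ, hκd⟩ : ∃ κ, κ = min ‖v₁ - v₀‖ (‖v₀‖ / 4) := ⟨_, rfl⟩
  rw [← hκd] at hlt
  -- Since `‖v₀‖ ^ (p - 2)` is a multiple of `d ^ (2 - α)`, this scale makes `‖v₀‖ ^ (p - 2) * (κ /
  -- R)` a constant over `c`, independent of `d` and `κ`. It also makes `R` small compared with `d`
  -- and the second order error a small multiple of `κ * R`.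
  obtain ⟨R, hRd⟩ : ∃ R, R = c * κ * d ^ (2 - α) := ⟨_, rfl⟩
  rw [← hRd] at hlt
  obtain ⟨r, hrd⟩ : ∃ r, r = ‖x₀ - x₁‖ := ⟨_, rfl⟩
  rw [← hrd] at hlt
  have hr0 : 0 ≤ r := by rw [hrd]; positivity
  have hR0 : 0 < R := pos_of_mul_pos_left (by linarith) hs0.le
  have hκ0 : 0 < κ := by
    rw [hRd] at hR0
    exact pos_of_mul_pos_right (pos_of_mul_pos_left hR0 (by positivity)) hc0.le
  have hrR : 8 * r ≤ R := hlt.le.trans (mul_le_of_le_one_right hR0.le hs1)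
  have hκ1 : κ ≤ ‖v₁ - v₀‖ := by rw [hκd]; exact min_le_left _ _
  have hκ4 : 4 * κ ≤ ‖v₀‖ := by
    have := min_le_right ‖v₁ - v₀‖ (‖v₀‖ / 4)
    rw [← hκd] at this; linarith
  have hdpow : d ^ (α - 1) * d ^ (2 - α) = d := by
    rw [← Real.rpow_add hd0, show α - 1 + (2 - α) = 1 by ring, Real.rpow_one]
  have hdpow2 : d ^ (α - 2) * d ^ (2 - α) = 1 := by
    rw [← Real.rpow_add hd0, show α - 2 + (2 - α) = 0 by ring, Real.rpow_zero]
  have hd1 : d ^ (α - 1) ≤ 1 := Real.rpow_le_one hd0.le (by linarith) (by linarith)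
  have hRd4 : 4 * R ≤ c * (A * α) * d := by
    have h1 : 4 * κ * (c * d ^ (2 - α)) ≤ ‖v₀‖ * (c * d ^ (2 - α)) :=
      mul_le_mul_of_nonneg_right hκ4 (by positivity)
    have h2 : ‖v₀‖ * (c * d ^ (2 - α)) = c * (A * α) * d := by
      rw [hv0n]
      linear_combination A * α * c * hdpow
    rw [hRd]; linarith
  have hRd4' : 4 * R ≤ d := hRd4.trans (mul_le_of_le_one_left hd0.le hc1)
  have hquad : A * powConst α * d ^ (α - 2) * R ^ 2 ≤ s₀ * κ * R / 64 := by
    have e : A * powConst α * d ^ (α - 2) * R ^ 2 = A * powConst α * c * (κ * R) := by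
      rw [sq]
      nth_rewrite 1 [hRd]
      linear_combination A * powConst α * c * κ * R * hdpow2
    rw [e]
    have : 0 < κ * R := by positivity
    have := mul_le_mul_of_nonneg_right hc2 this.le
    linarith only [this]
  have ht1 := ht.1
  have ht2 := ht.2
  have hball : ∀ x : EuclideanSpace ℝ (Fin n), ‖x - x₀‖ ≤ R → ‖x‖ < 1 := by
    intro x hx
    have := norm_le_insert' x x₀
    linarith
  have hmem : ∀ x τ, ‖x - x₀‖ ≤ R → τ ∈ Icc (t - 1 / 4) t → (x, τ) ∈ backwardUnitCylinder n :=
    fun x τ hx hτ => ⟨mem_ball_zero_iff.2 (hball x hx), by linarith [hτ.1], hτ.2.trans ht2⟩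
  have htt : t ∈ Icc (t - 1 / 4) t := ⟨by linarith, le_rfl⟩
  -- the lower bound coming from the first profile
  have hI0 : ∀ x τ, ‖x - x₀‖ ≤ R → τ ∈ Icc (t - 1 / 4) t →
      u (x₀, t) + 8 * (τ - t) + inner ℝ v₀ (x - x₀) - s₀ * κ * R / 64 ≤ u (x, τ) := by
    intro x τ hx hτ
    have h1 := hpast₀ (x, τ) (hmem x τ hx hτ) hτ.2
    have h2 := rpow_norm_add_le_of_comparable hα hd0 (w := x₀ - y₀) (z := x - x₀)
      (by rw [← hdd]; linarith) hdd.ge (by linarith)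
    rw [show x₀ - y₀ + (x - x₀) = x - y₀ by abel, ← hdd] at h2
    have h3 := mul_le_mul_of_nonneg_left h2 hA.le
    have h4 : A * powConst α * d ^ (α - 2) * ‖x - x₀‖ ^ 2 ≤ A * powConst α * d ^ (α - 2) * R ^ 2 := by
      gcongr
    rw [← hdd] at hle₀
    rw [hin0]
    simp only at h1 hle₀
    linarith only [h1, hle₀, h3, h4, hquad]
  -- the second order error of the second profile
  obtain ⟨η, hη0, hη, herr⟩ : ∃ η, 0 ≤ η ∧ η ≤ s₀ * κ * R / 16 ∧ ∀ z : EuclideanSpace ℝ (Fin n),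
      ‖z‖ ≤ 2 * R → A * ‖x₁ - y₁ + z‖ ^ α ≤ A * ‖x₁ - y₁‖ ^ α - inner ℝ v₁ z + η := by
    -- The point `x₁` may be near the vertex `y₁`, where the second order expansion fails if `α <
    -- 2`. In that case `‖x₁ - y₁‖ < d / 2`, the two slopes differ by a fixed fraction of `‖v₀‖`,
    -- and the cruder error `R ^ α` is absorbed by `κ * R`.
    by_cases hcase : 2 ≤ α ∨ d / 2 ≤ ‖x₁ - y₁‖
    · refine ⟨4 * (A * powConst α * d ^ (α - 2) * R ^ 2), by positivity, by linarith, ?_⟩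
      intro z hz
      have h1 : ‖x₁ - y₁ + z‖ ^ α ≤ ‖x₁ - y₁‖ ^ α + α * inner ℝ (powVec α (x₁ - y₁)) z
          + powConst α * d ^ (α - 2) * ‖z‖ ^ 2 := by
        rcases hcase with h | h
        · exact rpow_norm_add_le_of_two_le h hd0 hd₁ (by linarith)
        · exact rpow_norm_add_le_of_comparable hα hd0 h hd₁ (by linarith)
      have h2 := mul_le_mul_of_nonneg_left h1 hA.le
      have h3 : A * powConst α * d ^ (α - 2) * ‖z‖ ^ 2
          ≤ A * powConst α * d ^ (α - 2) * (2 * R) ^ 2 := by gcongr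
      rw [hin1]
      linarith only [h2, h3]
    · push Not at hcase
      obtain ⟨hα2, hdd1⟩ := hcase
      have hsmall := hc3 hα2
      refine ⟨A * powConst α * (2 * R) ^ α, by positivity, ?_, ?_⟩
      · have hgap : min (1 - (1 / 2) ^ (α - 1)) (1 / 4) * (A * α) * d ^ (α - 1) ≤ κ := by
          have hv1' : ‖v₁‖ ≤ A * α * ((1 / 2) ^ (α - 1) * d ^ (α - 1)) := by
            rw [hv1n, ← Real.mul_rpow (by norm_num) hd0.le]
            have : ‖x₁ - y₁‖ ^ (α - 1) ≤ (1 / 2 * d) ^ (α - 1) :=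
              Real.rpow_le_rpow (norm_nonneg _) (by linarith) (by linarith)
            gcongr
          have hpd : 0 < A * α * d ^ (α - 1) := by positivity
          rw [hκd, mul_assoc]
          refine le_min ?_ ?_
          · have h1 := norm_sub_norm_le v₀ v₁
            rw [norm_sub_rev] at h1
            refine le_trans ?_ h1
            rw [hv0n]
            have := mul_le_mul_of_nonneg_right
              (min_le_left (1 - (1 / 2 : ℝ) ^ (α - 1)) (1 / 4)) hpd.le
            linarith
          · rw [hv0n]
            have := mul_le_mul_of_nonneg_right
              (min_le_right (1 - (1 / 2 : ℝ) ^ (α - 1)) (1 / 4)) hpd.le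
            linarith
        have h1 : (2 * R) ^ α ≤ 4 * R ^ α := by
          rw [Real.mul_rpow (by norm_num) hR0.le]
          have : (2 : ℝ) ^ α ≤ 2 ^ (2 : ℝ) := Real.rpow_le_rpow_of_exponent_le (by norm_num) hα2.le
          rw [Real.rpow_two] at this
          have hRα : 0 < R ^ α := by positivity
          linarith only [mul_le_mul_of_nonneg_right this hRα.le]
        have h2 : R ^ α = R ^ (α - 1) * R := by
          rw [← Real.rpow_add_one hR0.ne']; congr 1; ring
        have h3 : R ^ (α - 1) ≤ (c * (A * α)) ^ (α - 1) * d ^ (α - 1) := by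
          rw [← Real.mul_rpow (by positivity) hd0.le]
          exact Real.rpow_le_rpow hR0.le (by linarith) (by linarith)
        calc A * powConst α * (2 * R) ^ α
            ≤ A * powConst α * (4 * (((c * (A * α)) ^ (α - 1) * d ^ (α - 1)) * R)) := by
              rw [h2] at h1
              have := mul_le_mul_of_nonneg_right h3 hR0.le
              gcongr
              linarith
          _ = 4 * (A * powConst α) * (c * (A * α)) ^ (α - 1) * (d ^ (α - 1) * R) := by ring
          _ ≤ s₀ / 16 * (min (1 - (1 / 2) ^ (α - 1)) (1 / 4) * (A * α)) * (d ^ (α - 1) * R) := by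
              gcongr
          _ = s₀ / 16 * R * (min (1 - (1 / 2) ^ (α - 1)) (1 / 4) * (A * α) * d ^ (α - 1)) := by ring
          _ ≤ s₀ / 16 * R * κ := by gcongr
          _ = s₀ * κ * R / 16 := by ring
      · intro z hz
        have h1 := rpow_norm_add_le_of_le_two hα hα2.le (x₁ - y₁) z
        have h2 := mul_le_mul_of_nonneg_left h1 hA.le
        have h3 : A * powConst α * ‖z‖ ^ α ≤ A * powConst α * (2 * R) ^ α := by gcongr
        rw [hin1]
        linarith only [h2, h3]
  have hrx : ‖x₁ - x₀‖ = r := by rw [hrd, norm_sub_rev]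
  have hI1 : ∀ x τ, ‖x - x₀‖ ≤ R → τ ∈ Icc (t - 1 / 4) t →
      u (x₀, t) + 8 * (τ - t) + inner ℝ v₀ (x - x₀) + inner ℝ (v₁ - v₀) (x - x₁)
        - (s₀ * κ * R / 16 + s₀ * κ * R / 64) ≤ u (x, τ) := by
    intro x τ hx hτ
    have h1 := hpast₁ (x, τ) (hmem x τ hx hτ) hτ.2
    have h2 := herr (x - x₁) (by
      have : ‖x - x₁‖ ≤ ‖x - x₀‖ + ‖x₀ - x₁‖ := norm_sub_le_norm_sub_add_norm_sub _ _ _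
      rw [← hrd] at this
      linarith)
    rw [show x₁ - y₁ + (x - x₁) = x - y₁ by abel] at h2
    -- The first bound at `x₁` anchors the second profile at the height of the first, up to the
    -- error.
    have h3 := hI0 x₁ t (by linarith) htt
    have h4 : (inner ℝ (v₁ - v₀) (x - x₁) : ℝ) = inner ℝ v₁ (x - x₁) - inner ℝ v₀ (x - x₀)
        + inner ℝ v₀ (x₁ - x₀) := by
      simp only [inner_sub_left, inner_sub_right]; ring
    rw [h4]
    simp only at h1 hle₁
    linarith only [h1, hle₁, h2, h3, hη]
  have hk0 : 0 < ‖v₁ - v₀‖ := hκ0.trans_le hκ1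
  obtain ⟨e, hed⟩ : ∃ e, e = ‖v₁ - v₀‖⁻¹ • (v₁ - v₀) := ⟨_, rfl⟩
  have he : ‖e‖ = 1 := by
    rw [hed, norm_smul, norm_inv, norm_norm, inv_mul_cancel₀ hk0.ne']
  have hve : v₁ - v₀ = ‖v₁ - v₀‖ • e := by
    rw [hed, smul_smul, mul_inv_cancel₀ hk0.ne', one_smul]
  refine hu.no_kink hlam hLam hu0 (x₀ := x₀) (t₀ := t) (θ := 1 / 4) (v := v₀) (e := e) (κ := κ)
    (a := u (x₀, t)) (b := 8) (E := κ * r + (s₀ * κ * R / 16 + s₀ * κ * R / 64)) he hR0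
    (by norm_num) hs0 hs1 hsP hκ0 hκ4 ?_ ?_ ?_ le_rfl ?_
  · have h1 : κ * (8 * r) < κ * (R * s₀) := mul_lt_mul_of_pos_left hlt hκ0
    have h2 : 0 < κ * (R * s₀) := by positivity
    linarith only [h1, h2]
  · rintro ⟨x, τ⟩ ⟨hx, hτ⟩
    exact hmem x τ (mem_closedBall_iff_norm.1 hx) hτ
  · intro x hx τ hτ
    have hx := mem_closedBall_iff_norm.1 hx
    have h0 := hI0 x τ hx hτ
    have h1 := hI1 x τ hx hτ
    have hκr : 0 ≤ κ * r := by positivity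
    have hsκ : 0 < s₀ * κ * R := by positivity
    rcases max_choice 0 (κ * inner ℝ e (x - x₀)) with hm | hm
    · rw [hm]
      linarith only [h0, hκr, hsκ]
    · rw [hm]
      -- Averaging the two lower bounds with weight `ω` replaces the full jump `‖v₁ - v₀‖` by the
      -- truncated `κ`.
      obtain ⟨ω, hωd⟩ : ∃ ω, ω = κ / ‖v₁ - v₀‖ := ⟨_, rfl⟩
      have hω0 : 0 ≤ ω := by rw [hωd]; positivity
      have hω1 : ω ≤ 1 := by rw [hωd]; exact (div_le_one hk0).2 hκ1
      have hωk : ω * ‖v₁ - v₀‖ = κ := by rw [hωd]; field_simp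
      have hi : inner ℝ e (x - x₀) - r ≤ inner ℝ e (x - x₁) := by
        have e1 : x - x₁ = (x - x₀) + (x₀ - x₁) := by abel
        have h2 := abs_real_inner_le_norm e (x₀ - x₁)
        rw [he, one_mul, ← hrd] at h2
        have h3 := (abs_le.1 h2).1
        rw [e1, inner_add_right]
        linarith
      have hj : inner ℝ (v₁ - v₀) (x - x₁) = ‖v₁ - v₀‖ * inner ℝ e (x - x₁) := by
        conv_lhs => rw [hve]
        rw [real_inner_smul_left]
      rw [hj] at h1
      have h2 := add_le_add (mul_le_mul_of_nonneg_left h0 (by linarith : 0 ≤ 1 - ω))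
        (mul_le_mul_of_nonneg_left h1 hω0)
      have h3 := mul_le_mul_of_nonneg_left hi hκ0.le
      have h4 : ω * (s₀ * κ * R / 16) ≤ 1 * (s₀ * κ * R / 16) :=
        mul_le_mul_of_nonneg_right hω1 (by positivity)
      have h5 : ω * (‖v₁ - v₀‖ * inner ℝ e (x - x₁)) = κ * inner ℝ e (x - x₁) := by
        rw [← mul_assoc, hωk]
      linarith only [h2, h3, h4, h5]
  · have h1 : 8 + κ * R * s₀ / (1 / 4) ≤ 8 + A * α := by
      have h2 : ‖v₀‖ ≤ A * α := by rw [hv0n]; exact mul_le_of_le_one_right hV0.le hd1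
      have h3 : R * s₀ ≤ R := mul_le_of_le_one_right hR0.le hs1
      have h4 : κ * (R * s₀) ≤ κ := mul_le_of_le_one_right hκ0.le (by linarith only [h3, hRd4', hd34])
      linarith only [h2, h4, hκ4]
    refine h1.trans_lt ?_
    have h2 : κ / R = (c * d ^ (2 - α))⁻¹ := by
      rw [hRd]; field_simp
    have h3 : ‖v₀‖ ^ (p - 2) = (A * α) ^ (p - 2) * d ^ (2 - α) := by
      rw [hv0n, Real.mul_rpow hV0.le (by positivity), ← Real.rpow_mul hd0.le, hαp]
    have h4 : (2 ^ |p - 2|)⁻¹ * ‖v₀‖ ^ (p - 2) * (κ / R)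
        = (2 ^ |p - 2|)⁻¹ * (A * α) ^ (p - 2) / c := by
      have : d ^ (2 - α) ≠ 0 := by positivity
      rw [h2, h3]; field_simp
    rw [h4, lt_div_iff₀ hc0, mul_comm]
    exact hc4

end ContactMap


/-! ### The contact set: Lipschitz dependence, existence, compactness -/

section Contact

variable {n : ℕ} {p lam Lam : ℝ} {u : SpaceTime n → ℝ}

/-- At equal times, the vertices of the profiles in contact with `u` depend in a Lipschitz way on
the contact points. -/
theorem exists_contact_lipschitz (n : ℕ) (hp : 1 < p) (hlam : 0 < lam) (hLam : lam ≤ Lam)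
    {A : ℝ} (hA : 0 < A) : ∃ C : NNReal, 0 < C ∧ ∀ u : SpaceTime n → ℝ,
      IsViscositySupersolution p lam Lam
        (Metric.ball (0 : EuclideanSpace ℝ (Fin n)) 1) (-1) 0 u →
      (∀ z ∈ backwardUnitCylinder n, 0 ≤ u z) →
      ∀ (x₀ x₁ y₀ y₁ : EuclideanSpace ℝ (Fin n)) (t h₀ h₁ : ℝ),
      ‖x₀‖ ≤ 1 / 2 → ‖x₁‖ ≤ 1 / 2 → ‖y₀‖ ≤ 1 / 4 → ‖y₁‖ ≤ 1 / 4 → t ∈ Icc (-(1 / 2) : ℝ) 0 →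
      contactLevel p A u y₀ (x₀, t) ≤ h₀ →
      (∀ z ∈ backwardUnitCylinder n, z.2 ≤ t → h₀ ≤ contactLevel p A u y₀ z) →
      contactLevel p A u y₁ (x₁, t) ≤ h₁ →
      (∀ z ∈ backwardUnitCylinder n, z.2 ≤ t → h₁ ≤ contactLevel p A u y₁ z) →
      ‖y₀ - y₁‖ ≤ C * ‖x₀ - x₁‖ := by
  obtain ⟨s₀, hs0, hs1, hsP⟩ := exists_kink_width (n := n) hlam hLam
  obtain ⟨c, hc⟩ := exists_isKinkScale hp hA hs0
  have hα := one_lt_conj hp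
  have hV0 : 0 < A * (p / (p - 1)) := mul_pos hA (by linarith)
  have hc0 := hc.pos
  have hαp : (p / (p - 1) - 1) * (p - 2) = 2 - p / (p - 1) := by
    field_simp [(by linarith : p - 1 ≠ 0)]; ring
  set C : ℝ := 1 + (p + 2) / (A * (p / (p - 1))) * (8 / (c * s₀))
    + 64 / (c * s₀ * (A * (p / (p - 1)))) with hC
  have hp2 : 0 < p + 2 := by linarith
  have hC0 : 0 < C := by positivity
  refine ⟨⟨C, hC0.le⟩, hC0, ?_⟩
  intro u hu hu0
  have key : ∀ (x₀ x₁ y₀ y₁ : EuclideanSpace ℝ (Fin n)) (t h₀ h₁ : ℝ),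
      ‖x₀‖ ≤ 1 / 2 → ‖y₀‖ ≤ 1 / 4 → t ∈ Icc (-(1 / 2) : ℝ) 0 →
      contactLevel p A u y₀ (x₀, t) ≤ h₀ →
      (∀ z ∈ backwardUnitCylinder n, z.2 ≤ t → h₀ ≤ contactLevel p A u y₀ z) →
      contactLevel p A u y₁ (x₁, t) ≤ h₁ →
      (∀ z ∈ backwardUnitCylinder n, z.2 ≤ t → h₁ ≤ contactLevel p A u y₁ z) →
      ‖x₁ - y₁‖ ≤ ‖x₀ - y₀‖ → ‖y₀ - y₁‖ ≤ C * ‖x₀ - x₁‖ := by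
    intro x₀ x₁ y₀ y₁ t h₀ h₁ hx₀ hy₀ ht hle₀ hpast₀ hle₁ hpast₁ hd₁
    obtain ⟨r, hr⟩ : ∃ r, r = ‖x₀ - x₁‖ := ⟨_, rfl⟩
    have hr0 : 0 ≤ r := by rw [hr]; positivity
    have hyw : y₀ - y₁ = (x₀ - x₁) + ((x₁ - y₁) - (x₀ - y₀)) := by abel
    have hy := norm_add_le (x₀ - x₁) ((x₁ - y₁) - (x₀ - y₀))
    rw [← hyw, ← hr] at hy
    rw [← hr]
    have hC1 : r ≤ C * r := le_mul_of_one_le_left hr0 (by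
      have : 0 ≤ (p + 2) / (A * (p / (p - 1))) * (8 / (c * s₀)) := by positivity
      have : 0 ≤ 64 / (c * s₀ * (A * (p / (p - 1)))) := by positivity
      rw [hC]; linarith)
    rcases eq_or_ne (x₀ - y₀) 0 with hw | hw
    · rw [hw, norm_zero] at hd₁
      have h1 : x₁ - y₁ = 0 := norm_le_zero_iff.1 hd₁
      rw [hw, h1, sub_zero, norm_zero] at hy
      linarith
    have hkink := hu.kink_le hp hlam hLam hu0 hA hs0 hs1 hsP hc hx₀ hy₀ ht hle₀ hpast₀ hle₁ hpast₁
      hw hd₁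
    rw [← hr] at hkink
    have hd0 : 0 < ‖x₀ - y₀‖ := norm_pos_iff.2 hw
    have hkink' : min ‖profileGradient p A (x₁ - y₁) - profileGradient p A (x₀ - y₀)‖
        (‖profileGradient p A (x₀ - y₀)‖ / 4) * ‖x₀ - y₀‖ ^ (2 - p / (p - 1))
        ≤ 8 / (c * s₀) * r := by
      rw [div_mul_eq_mul_div, le_div_iff₀ (by positivity)]
      linarith
    rcases min_choice ‖profileGradient p A (x₁ - y₁) - profileGradient p A (x₀ - y₀)‖
        (‖profileGradient p A (x₀ - y₀)‖ / 4) with hm | hm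
    · rw [hm] at hkink'
      have e1 : profileGradient p A (x₁ - y₁) - profileGradient p A (x₀ - y₀)
          = (A * (p / (p - 1))) •
            (powVec (p / (p - 1)) (x₀ - y₀) - powVec (p / (p - 1)) (x₁ - y₁)) := by
        rw [profileGradient, profileGradient, smul_sub]; abel
      rw [e1, norm_smul, Real.norm_of_nonneg hV0.le] at hkink'
      have hle : ‖powVec (p / (p - 1)) (x₁ - y₁)‖ ≤ ‖powVec (p / (p - 1)) (x₀ - y₀)‖ := by
        rw [norm_powVec hα, norm_powVec hα]
        exact Real.rpow_le_rpow (norm_nonneg _) hd₁ (by linarith)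
      -- Inverting the slope map costs the factor `d ^ ((α - 1)(p - 2)) = d ^ (2 - α)`, with `d =
      -- ‖x₀ - y₀‖`; this is exactly the weight in the kink estimate.
      have h1 := norm_powVec_sub_le hp hle
      rw [powVec_powVec hp, powVec_powVec hp, norm_powVec hα, ← Real.rpow_mul hd0.le, hαp,
        norm_sub_rev] at h1
      have h2 : ‖x₁ - y₁ - (x₀ - y₀)‖ ≤ (p + 2) / (A * (p / (p - 1))) * (8 / (c * s₀) * r) := by
        refine h1.trans ?_
        have h3 := mul_le_mul_of_nonneg_left hkink'
          (by positivity : 0 ≤ (p + 2) / (A * (p / (p - 1))))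
        refine le_trans (le_of_eq ?_) h3
        generalize p / (p - 1) = α at *
        have : α ≠ 0 := by linarith
        field_simp
      have h3 : 0 ≤ 64 / (c * s₀ * (A * (p / (p - 1)))) * r := by positivity
      rw [hC]
      linarith
    · rw [hm, norm_profileGradient hp hA] at hkink'
      have hdpow : ‖x₀ - y₀‖ ^ (p / (p - 1) - 1) * ‖x₀ - y₀‖ ^ (2 - p / (p - 1)) = ‖x₀ - y₀‖ := by
        rw [← Real.rpow_add hd0, show p / (p - 1) - 1 + (2 - p / (p - 1)) = 1 by ring,
          Real.rpow_one]
      have h1 : A * (p / (p - 1)) * ‖x₀ - y₀‖ ≤ 32 / (c * s₀) * r := by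
        have h2 : A * (p / (p - 1)) * ‖x₀ - y₀‖ ^ (p / (p - 1) - 1) / 4
            * ‖x₀ - y₀‖ ^ (2 - p / (p - 1)) = A * (p / (p - 1)) * ‖x₀ - y₀‖ / 4 := by
          linear_combination A * (p / (p - 1)) / 4 * hdpow
        rw [h2] at hkink'
        have h3 : 32 / (c * s₀) * r = 4 * (8 / (c * s₀) * r) := by ring
        linarith
      -- If the truncation is active, `x₀ - y₀` itself is controlled by `r`, and so is the shorter
      -- `x₁ - y₁`.
      have h2 : 2 * ‖x₀ - y₀‖ ≤ 64 / (c * s₀ * (A * (p / (p - 1)))) * r := by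
        have h3 : 64 / (c * s₀ * (A * (p / (p - 1)))) * r
            = 2 * (32 / (c * s₀) * r) / (A * (p / (p - 1))) := by
          generalize p / (p - 1) = α at *
          have : α ≠ 0 := by linarith
          field_simp
          ring
        rw [h3, le_div_iff₀ hV0]
        linarith
      have h3 := norm_sub_le (x₁ - y₁) (x₀ - y₀)
      have h4 : 0 ≤ (p + 2) / (A * (p / (p - 1))) * (8 / (c * s₀)) * r := by positivity
      rw [hC]
      linarith
  intro x₀ x₁ y₀ y₁ t h₀ h₁ hx₀ hx₁ hy₀ hy₁ ht hle₀ hpast₀ hle₁ hpast₁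
  rcases le_total ‖x₁ - y₁‖ ‖x₀ - y₀‖ with h | h
  · exact key x₀ x₁ y₀ y₁ t h₀ h₁ hx₀ hy₀ ht hle₀ hpast₀ hle₁ hpast₁ h
  · rw [norm_sub_rev y₀, norm_sub_rev x₀]
    exact key x₁ x₀ y₁ y₀ t h₁ h₀ hx₁ hy₁ ht hle₁ hpast₁ hle₀ hpast₀ h

/-- The profile with vertex `y` and level `h` meets `u` at `(x, t)`, and stays below `u` before `t`.
The condition after `t` is automatic for supersolutions and makes the set of contacts closed. -/
structure IsContact (p A L ρ : ℝ) (u : SpaceTime n → ℝ) (x y : EuclideanSpace ℝ (Fin n))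
    (t h : ℝ) : Prop where
  norm_le : ‖x‖ ≤ 1 / 2
  norm_vertex_le : ‖y‖ ≤ ρ
  time_mem : t ∈ Icc (-(1 / 2) : ℝ) 0
  level_mem : h ∈ Icc (2 : ℝ) 3
  le_level : contactLevel p A u y (x, t) ≤ h
  level_le : ∀ z ∈ backwardUnitCylinder n, h - L * max (z.2 - t) 0 ≤ contactLevel p A u y z

theorem IsContact.level_le_of_le {A L ρ : ℝ} {x y : EuclideanSpace ℝ (Fin n)} {t h : ℝ}
    (hc : IsContact p A L ρ u x y t h) {z : SpaceTime n} (hz : z ∈ backwardUnitCylinder n)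
    (hzt : z.2 ≤ t) : h ≤ contactLevel p A u y z := by
  have := hc.level_le z hz
  rwa [max_eq_right (by linarith), mul_zero, sub_zero] at this

theorem half_cylinder_subset :
    Metric.closedBall (0 : EuclideanSpace ℝ (Fin n)) (1 / 2) ×ˢ Icc (-(1 / 2) : ℝ) 0
      ⊆ backwardUnitCylinder n := by
  rintro ⟨x, τ⟩ ⟨hx, hτ⟩
  rw [mem_closedBall_zero_iff] at hx
  exact ⟨mem_ball_zero_iff.2 (by linarith), by linarith [hτ.1], hτ.2⟩

theorem IsContact.mem {A L ρ : ℝ} {x y : EuclideanSpace ℝ (Fin n)} {t h : ℝ}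
    (hc : IsContact p A L ρ u x y t h) : (x, t) ∈ backwardUnitCylinder n :=
  half_cylinder_subset ⟨mem_closedBall_zero_iff.2 hc.norm_le, hc.time_mem⟩

/-- Each contact point is inserted in the lower bound of the other contact; one bound uses the past
of a contact and the other its future. -/
theorem IsContact.abs_sub_le {A L ρ : ℝ} (hL : 0 ≤ L) {x x' y : EuclideanSpace ℝ (Fin n)}
    {t t' h h' : ℝ} (hc : IsContact p A L ρ u x y t h) (hc' : IsContact p A L ρ u x' y t' h') :
    |h - h'| ≤ L * |t - t'| := by
  have h1 := (hc.level_le _ hc'.mem).trans hc'.le_level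
  have h2 := (hc'.level_le _ hc.mem).trans hc.le_level
  have h3 : L * max (t' - t) 0 ≤ L * |t - t'| := by
    rw [abs_sub_comm]
    exact mul_le_mul_of_nonneg_left (max_le (le_abs_self _) (abs_nonneg _)) hL
  have h4 : L * max (t - t') 0 ≤ L * |t - t'| :=
    mul_le_mul_of_nonneg_left (max_le (le_abs_self _) (abs_nonneg _)) hL
  simp only at h1 h2
  rw [abs_le]
  constructor <;> linarith

theorem continuous_profile (hp : 1 < p) (A : ℝ) :
    Continuous fun q : EuclideanSpace ℝ (Fin n) × EuclideanSpace ℝ (Fin n) =>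
      A * ‖q.1 - q.2‖ ^ (p / (p - 1)) := by
  have := one_lt_conj hp
  have h1 : Continuous fun q : EuclideanSpace ℝ (Fin n) × EuclideanSpace ℝ (Fin n) =>
      ‖q.1 - q.2‖ ^ (p / (p - 1)) :=
    (continuous_fst.sub continuous_snd).norm.rpow_const fun _ => Or.inr (by linarith)
  exact h1.const_mul A

/-- At the origin the contact level is at most `1 + 1 ≤ h`, so a first time with level at most `h`
exists by compactness. Such a level is impossible for `‖x‖ > 1/2`, where the profile term is at
least 4, and for `t < -1/2`, where `-8 t > 4`. -/
theorem IsViscositySupersolution.exists_isContact (hu : IsViscositySupersolution p lam Lam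
      (Metric.ball (0 : EuclideanSpace ℝ (Fin n)) 1) (-1) 0 u) (hn : 1 ≤ n) (hp : 1 < p)
    (hlam : 0 < lam) (hLam : lam ≤ Lam)
    (hu0 : ∀ z ∈ backwardUnitCylinder n, 0 ≤ u z) (hu1 : u (0, 0) ≤ 1)
    {A : ℝ} {k : ℕ} (hk : 2 ≤ k) (hkp : 1 < (2 * k - 1) * (p - 1)) (hA : 0 < A)
    (hA4 : 4 ≤ A * (1 / 4) ^ (p / (p - 1))) {ρ : ℝ} (hρ4 : ρ ≤ 1 / 4)
    (hρA : A * ρ ^ (p / (p - 1)) ≤ 1)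
    {y : EuclideanSpace ℝ (Fin n)} (hy : ‖y‖ ≤ ρ) {h : ℝ} (hh : h ∈ Icc (2 : ℝ) 3) :
    ∃ x t, IsContact p A (decayConst n p lam Lam A k) ρ u x y t h := by
  have hα := one_lt_conj hp
  set L := decayConst n p lam Lam A k with hL
  have hcont : Continuous fun z : SpaceTime n => -8 * z.2 + A * ‖z.1 - y‖ ^ (p / (p - 1)) := by
    have := (continuous_profile (n := n) hp A).comp
      (continuous_fst.prodMk continuous_const : Continuous fun z : SpaceTime n => (z.1, y))
    exact (continuous_snd.const_mul (-8)).add this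
  have hK : IsCompact (Metric.closedBall (0 : EuclideanSpace ℝ (Fin n)) (1 / 2) ×ˢ
      Icc (-(1 / 2) : ℝ) 0) := (isCompact_closedBall 0 (1 / 2)).prod isCompact_Icc
  have hlsc : LowerSemicontinuousOn (fun z => u z + (-8 * z.2 + A * ‖z.1 - y‖ ^ (p / (p - 1))))
      (Metric.closedBall (0 : EuclideanSpace ℝ (Fin n)) (1 / 2) ×ˢ Icc (-(1 / 2) : ℝ) 0) :=
    (hu.lowerSemicontinuousOn.mono half_cylinder_subset).add
      (hcont.lowerSemicontinuous.lowerSemicontinuousOn _)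
  have heq : ∀ z, u z + (-8 * z.2 + A * ‖z.1 - y‖ ^ (p / (p - 1))) = contactLevel p A u y z :=
    fun z => by rw [contactLevel]; ring
  simp only [heq] at hlsc
  have hcpt := hlsc.isCompact_inter_preimage_Iic hK h
  have hne : ((0 : EuclideanSpace ℝ (Fin n)), (0 : ℝ)) ∈
      (Metric.closedBall (0 : EuclideanSpace ℝ (Fin n)) (1 / 2) ×ˢ Icc (-(1 / 2) : ℝ) 0)
        ∩ contactLevel p A u y ⁻¹' Iic h := by
    refine ⟨⟨Metric.mem_closedBall_self (by norm_num), by norm_num⟩, ?_⟩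
    have h1 : A * ‖y‖ ^ (p / (p - 1)) ≤ A * ρ ^ (p / (p - 1)) := by gcongr
    simp only [mem_preimage, contactLevel, zero_sub, norm_neg, mem_Iic]
    linarith [hh.1]
  obtain ⟨⟨x, t⟩, ⟨⟨hx, ht⟩, hle⟩, hmin⟩ := hcpt.exists_isMinOn ⟨_, hne⟩ continuous_snd.continuousOn
  have hle : contactLevel p A u y (x, t) ≤ h := hle
  have hbefore : ∀ z ∈ backwardUnitCylinder n, z.2 < t → h < contactLevel p A u y z := by
    intro z hz hzt
    by_contra! hlt
    have hz2 : z.2 ≤ 0 := hz.2.2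
    have hprof : 0 ≤ A * ‖z.1 - y‖ ^ (p / (p - 1)) := by positivity
    have hm : z ∈ (Metric.closedBall (0 : EuclideanSpace ℝ (Fin n)) (1 / 2) ×ˢ
        Icc (-(1 / 2) : ℝ) 0) ∩ contactLevel p A u y ⁻¹' Iic h := by
      refine ⟨⟨mem_closedBall_zero_iff.2 ?_, ?_, hz2⟩, hlt⟩
      · by_contra! hx
        have h1 := four_le_of_half_le_norm hp hA hA4 (hy.trans hρ4) hx.le
        have h2 := hu0 z hz
        rw [contactLevel] at hlt
        linarith [hh.2]
      · by_contra! hτ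
        have h2 := hu0 z hz
        rw [contactLevel] at hlt
        linarith [hh.2]
    have : t ≤ z.2 := hmin hm
    linarith
  refine ⟨x, t, mem_closedBall_zero_iff.1 hx, hy, ht, hh, hle, ?_⟩
  intro z hz
  rcases lt_or_ge z.2 t with hzt | hzt
  · rw [max_eq_right (by linarith), mul_zero, sub_zero]
    exact (hbefore z hz hzt).le
  · rw [max_eq_left (by linarith)]
    -- Minimality of `t` gives the bound by `h` only strictly before `t`, so decay is started from
    -- times `s < t` and the limit `s → t` is taken.
    have h1 : ∀ᶠ s in 𝓝[<] t, h - L * (z.2 - s) ≤ contactLevel p A u y z := by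
      have h2 : ∀ᶠ s in 𝓝[<] t, -1 < s := nhdsWithin_le_nhds (lt_mem_nhds (by linarith [ht.1]))
      filter_upwards [self_mem_nhdsWithin, h2] with s hs hs1
      have hs : s < t := hs
      exact hu.contactLevel_decay hn hp hlam hLam hu0 hk hkp hA hA4 (hy.trans hρ4) hs1 hh.2
        (fun z' hz' hz's => (hbefore z' hz' (hz's.trans_lt hs)).le) hz (hs.le.trans hzt)
    have h2 : Tendsto (fun s => h - L * (z.2 - s)) (𝓝[<] t) (𝓝 (h - L * (z.2 - t))) :=
      ((by fun_prop : Continuous fun s => h - L * (z.2 - s)).tendsto t).mono_left nhdsWithin_le_nhds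
    exact le_of_tendsto h2 h1

/-- The set is a projection of a compact set of `(x, t, y, h)`: `le_level` is a sublevel condition
of a lower semicontinuous function, and `level_le` is, for each fixed `z`, a closed condition in
`(y, t, h)` in which `u z` is a constant. -/
theorem isCompact_setOf_isContact (hp : 1 < p) {A L ρ : ℝ}
    (hu : LowerSemicontinuousOn u (backwardUnitCylinder n)) :
    IsCompact {q : SpaceTime n | ∃ x h, IsContact p A L ρ u x q.1 q.2 h} := by
  set D : Set (SpaceTime n × SpaceTime n) :=
    (Metric.closedBall 0 (1 / 2) ×ˢ Icc (-(1 / 2) : ℝ) 0) ×ˢ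
      (Metric.closedBall 0 ρ ×ˢ Icc (2 : ℝ) 3) with hD
  have hDc : IsCompact D := ((isCompact_closedBall _ _).prod isCompact_Icc).prod
    ((isCompact_closedBall _ _).prod isCompact_Icc)
  have hprof := continuous_profile (n := n) hp A
  have hcont : Continuous fun q : SpaceTime n × SpaceTime n =>
      -8 * q.1.2 + A * ‖q.1.1 - q.2.1‖ ^ (p / (p - 1)) - q.2.2 := by
    have := hprof.comp (by fun_prop :
      Continuous fun q : SpaceTime n × SpaceTime n => (q.1.1, q.2.1))
    have h2 : Continuous fun q : SpaceTime n × SpaceTime n => -8 * q.1.2 := by fun_prop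
    exact (h2.add this).sub (by fun_prop)
  have hlsc : LowerSemicontinuousOn (fun q : SpaceTime n × SpaceTime n =>
      u q.1 + (-8 * q.1.2 + A * ‖q.1.1 - q.2.1‖ ^ (p / (p - 1)) - q.2.2)) D := by
    refine LowerSemicontinuousOn.add ?_ (hcont.lowerSemicontinuous.lowerSemicontinuousOn _)
    intro q hq a ha
    have h1 := hu q.1 (half_cylinder_subset hq.1) a ha
    exact (continuous_fst.continuousWithinAt (s := D) (x := q)).tendsto_nhdsWithin
      (t := backwardUnitCylinder n) (fun q' hq' => half_cylinder_subset hq'.1) |>.eventually h1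
  have h1 := hlsc.isCompact_inter_preimage_Iic hDc 0
  have h2 : IsClosed {q : SpaceTime n × SpaceTime n | ∀ z ∈ backwardUnitCylinder n,
      q.2.2 - L * max (z.2 - q.1.2) 0 ≤ contactLevel p A u q.2.1 z} := by
    simp only [Set.ofPred_forall]
    refine isClosed_iInter fun z => isClosed_iInter fun _ => isClosed_le (by fun_prop) ?_
    simp only [contactLevel]
    have hpair : Continuous fun q : SpaceTime n × SpaceTime n => (z.1, q.2.1) := by fun_prop
    have hz := hprof.comp hpair
    exact continuous_const.add hz
  have hproj : Continuous fun q : SpaceTime n × SpaceTime n => ((q.2.1, q.1.2) : SpaceTime n) :=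
    (continuous_fst.comp continuous_snd).prodMk (continuous_snd.comp continuous_fst)
  have h3 := (h1.inter_right h2).image hproj
  convert h3 using 1
  ext ⟨y, t⟩
  constructor
  · rintro ⟨x, h, hc⟩
    refine ⟨((x, t), (y, h)), ⟨⟨⟨⟨?_, hc.time_mem⟩, ?_, hc.level_mem⟩, ?_⟩, hc.level_le⟩, rfl⟩
    · exact mem_closedBall_zero_iff.2 hc.norm_le
    · exact mem_closedBall_zero_iff.2 hc.norm_vertex_le
    · have := hc.le_level
      simp only [contactLevel] at this
      simp only [mem_preimage, mem_Iic]
      linarith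
  · rintro ⟨⟨⟨x, t'⟩, ⟨y', h⟩⟩, ⟨⟨⟨⟨hx, ht⟩, hy, hh⟩, hle⟩, hge⟩, heq⟩
    obtain ⟨rfl, rfl⟩ := Prod.mk.inj heq
    refine ⟨x, h, mem_closedBall_zero_iff.1 hx, mem_closedBall_zero_iff.1 hy, ht, hh, ?_, hge⟩
    simp only [mem_preimage, mem_Iic] at hle
    simp only [contactLevel]
    linarith

end Contact

/-! ### Measure of the range of a Lipschitz relation -/

/-- A Lipschitz relation increases the Haar measure by at most the `d`-th power of the constant. -/
theorem addHaar_le_of_lipschitz_relation {E : Type*} [NormedAddCommGroup E] [NormedSpace ℝ E]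
    [FiniteDimensional ℝ E] [MeasurableSpace E] [BorelSpace E] (μ : Measure E)
    [μ.IsAddHaarMeasure] {K : NNReal} {S T : Set E} (r : E → E → Prop)
    (hT : ∀ y ∈ T, ∃ x ∈ S, r x y)
    (hr : ∀ x y x' y', r x y → r x' y' → dist y y' ≤ K * dist x x') :
    μ T ≤ (K : ENNReal) ^ Module.finrank ℝ E * μ S := by
  classical
  set S' : Set E := {x ∈ S | ∃ y, r x y} with hS'
  set f : E → E := fun x => if hx : ∃ y, r x y then hx.choose else 0 with hf
  have hfr : ∀ x ∈ S', r x (f x) := by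
    intro x hx
    simp only [hf, dif_pos hx.2]
    exact hx.2.choose_spec
  have hlip : LipschitzOnWith K f S' := LipschitzOnWith.of_dist_le_mul fun x hx x' hx' =>
    hr _ _ _ _ (hfr x hx) (hfr x' hx')
  have hsub : T ⊆ f '' S' := by
    intro y hy
    obtain ⟨x, hx, hxy⟩ := hT y hy
    have hx' : x ∈ S' := ⟨hx, y, hxy⟩
    refine ⟨x, hx', ?_⟩
    -- The estimate at equal first arguments makes the relation single-valued, so the chosen value
    -- is `y`.
    have := hr _ _ _ _ (hfr x hx') hxy
    rw [dist_self, mul_zero] at this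
    exact dist_le_zero.1 this
  have hH := hlip.hausdorffMeasure_image_le (d := Module.finrank ℝ E) (by positivity)
  rw [ENNReal.rpow_natCast] at hH
  -- Haar measure is a multiple of Hausdorff measure of the full dimension, for which the Lipschitz
  -- bound is known.
  have hμ := Measure.isAddLeftInvariant_eq_smul μ
    (Measure.hausdorffMeasure (Module.finrank ℝ E : ℝ) : Measure E)
  calc μ T ≤ μ (f '' S') := measure_mono hsub
    _ ≤ (K : ENNReal) ^ Module.finrank ℝ E * μ S' := by
      rw [hμ]
      simp only [Measure.smul_apply, ENNReal.smul_def, smul_eq_mul]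
      rw [mul_left_comm]
      gcongr
    _ ≤ (K : ENNReal) ^ Module.finrank ℝ E * μ S := by
      gcongr
      exact fun x hx => hx.1

end

/-! ### Conclusion by Fubini -/

theorem lemma3p2 (n : ℕ) (hn : 1 ≤ n) (p lam Lam : ℝ) (hp : 1 < p)
    (hlam : 0 < lam) (hLam : lam ≤ Lam) :
    ∃ c₀ : ℝ, 0 < c₀ ∧ ∀ u : SpaceTime n → ℝ,
      IsViscositySupersolution p lam Lam
        (Metric.ball (0 : EuclideanSpace ℝ (Fin n)) 1) (-1) 0 u →
      (∀ z ∈ backwardUnitCylinder n, 0 ≤ u z) →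
      u (0, 0) ≤ 1 →
      ENNReal.ofReal c₀ ≤ volume {z : SpaceTime n | z ∈ backwardUnitCylinder n ∧ u z < 4} := by
  have hα := one_lt_conj hp
  obtain ⟨k, hk, hkp⟩ : ∃ k : ℕ, 2 ≤ k ∧ 1 < (2 * k - 1) * (p - 1) := by
    obtain ⟨k, hk⟩ := exists_nat_gt (1 / (p - 1))
    rw [div_lt_iff₀ (by linarith)] at hk
    refine ⟨k + 2, by omega, ?_⟩
    have : (0 : ℝ) ≤ k := k.cast_nonneg
    push_cast
    nlinarith
  have h4 : (0 : ℝ) < (1 / 4) ^ (p / (p - 1)) := by positivity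
  obtain ⟨A, hA, hA4⟩ : ∃ A : ℝ, 0 < A ∧ A * (1 / 4) ^ (p / (p - 1)) = 4 :=
    ⟨4 / (1 / 4) ^ (p / (p - 1)), by positivity, by field_simp⟩
  obtain ⟨ρ, hρ0, hρ4, hρA⟩ : ∃ ρ : ℝ, 0 < ρ ∧ ρ ≤ 1 / 4 ∧ A * ρ ^ (p / (p - 1)) ≤ 1 := by
    -- With this radius `A * ρ ^ α = 4 * (1 / 4) = 1`.
    refine ⟨1 / 4 * (1 / 4) ^ (p / (p - 1))⁻¹, by positivity, ?_, ?_⟩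
    · have : (1 / 4 : ℝ) ^ (p / (p - 1))⁻¹ ≤ 1 :=
        Real.rpow_le_one (by norm_num) (by norm_num) (by positivity)
      linarith
    · rw [Real.mul_rpow (by norm_num) (by positivity), ← Real.rpow_mul (by norm_num),
        inv_mul_cancel₀ (by linarith), Real.rpow_one, ← mul_assoc, hA4]
      norm_num
  obtain ⟨L, hLd⟩ : ∃ L, L = decayConst n p lam Lam A k := ⟨_, rfl⟩
  have hL0 : 0 < L := by rw [hLd]; exact decayConst_pos hp hlam hLam hA hk
  obtain ⟨C, hC0, hC⟩ := exists_contact_lipschitz n hp hlam hLam hA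
  set B := Metric.closedBall (0 : EuclideanSpace ℝ (Fin n)) ρ with hB
  have hB0 : 0 < volume B := Metric.measure_closedBall_pos _ _ hρ0
  have hBtop : volume B ≠ ⊤ := measure_closedBall_lt_top.ne
  refine ⟨(volume B).toReal / (L * (C : ℝ) ^ n), div_pos (ENNReal.toReal_pos hB0.ne' hBtop)
    (by positivity), ?_⟩
  intro u hu hu0 hu1
  set T : Set (SpaceTime n) := {q | ∃ x h, IsContact p A L ρ u x q.1 q.2 h} with hT
  have hTm : MeasurableSet T :=
    (isCompact_setOf_isContact hp hu.lowerSemicontinuousOn).isClosed.measurableSet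
  -- The closed condition `u ≤ 3` makes `E` compact, hence measurable, and it holds at every contact
  -- point because `h ≤ 3` and `t ≤ 0`.
  set E : Set (SpaceTime n) := (Metric.closedBall (0 : EuclideanSpace ℝ (Fin n)) (1 / 2) ×ˢ
    Icc (-(1 / 2) : ℝ) 0) ∩ u ⁻¹' Iic 3 with hE
  have hEm : MeasurableSet E :=
    ((hu.lowerSemicontinuousOn.mono half_cylinder_subset).isCompact_inter_preimage_Iic
      ((isCompact_closedBall 0 (1 / 2)).prod isCompact_Icc) 3).isClosed.measurableSet
  have hEsub : E ⊆ {z : SpaceTime n | z ∈ backwardUnitCylinder n ∧ u z < 4} := by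
    intro z hz
    have : u z ≤ 3 := hz.2
    exact ⟨half_cylinder_subset hz.1, by linarith⟩
  -- All levels in `[2, 3]` are reached, and the level is an `L`-Lipschitz function of the contact
  -- time.
  have hfib1 : ∀ y ∈ B, 1 ≤ ENNReal.ofReal L * volume (Prod.mk y ⁻¹' T) := by
    intro y hy
    have := addHaar_le_of_lipschitz_relation (volume : Measure ℝ) (K := L.toNNReal)
      (S := Prod.mk y ⁻¹' T) (T := Icc 2 3) (fun t h => ∃ x, IsContact p A L ρ u x y t h) ?_ ?_
    · rw [Module.finrank_self, pow_one, Real.volume_Icc] at this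
      norm_num at this
      exact this
    · intro h hh
      obtain ⟨x, t, hc⟩ := hu.exists_isContact hn hp hlam hLam hu0 hu1 hk hkp hA hA4.ge hρ4 hρA
        (mem_closedBall_zero_iff.1 hy) hh
      rw [← hLd] at hc
      exact ⟨t, ⟨x, h, hc⟩, x, hc⟩
    · rintro t h t' h' ⟨x, hc⟩ ⟨x', hc'⟩
      rw [Real.dist_eq, Real.dist_eq, Real.coe_toNNReal _ hL0.le]
      exact hc.abs_sub_le hL0.le hc'
  have hfib2 : ∀ t, volume ((fun y => (y, t)) ⁻¹' T)
      ≤ (C : ENNReal) ^ n * volume ((fun x => (x, t)) ⁻¹' E) := by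
    intro t
    have := addHaar_le_of_lipschitz_relation (volume : Measure (EuclideanSpace ℝ (Fin n))) (K := C)
      (S := (fun x => (x, t)) ⁻¹' E) (T := (fun y => (y, t)) ⁻¹' T)
      (fun x y => ∃ h, IsContact p A L ρ u x y t h) ?_ ?_
    · rwa [finrank_euclideanSpace_fin] at this
    · rintro y ⟨x, h, hc⟩
      refine ⟨x, ⟨⟨mem_closedBall_zero_iff.2 hc.norm_le, hc.time_mem⟩, ?_⟩, h, hc⟩
      have h1 := hc.le_level
      have h2 : 0 ≤ A * ‖x - y‖ ^ (p / (p - 1)) := by positivity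
      have h3 := hc.level_mem.2
      have h5 := hc.time_mem.2
      simp only [contactLevel] at h1
      simp only [mem_preimage, mem_Iic]
      linarith
    · rintro x y x' y' ⟨h, hc⟩ ⟨h', hc'⟩
      rw [dist_eq_norm, dist_eq_norm]
      exact hC u hu hu0 x x' y y' t h h' hc.norm_le hc'.norm_le (hc.norm_vertex_le.trans hρ4)
        (hc'.norm_vertex_le.trans hρ4) hc.time_mem hc.le_level
        (fun z hz hzt => hc.level_le_of_le hz hzt) hc'.le_level
        (fun z hz hzt => hc'.level_le_of_le hz hzt)
  have hmain : volume B ≤ ENNReal.ofReal L * ((C : ENNReal) ^ n * volume E) := by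
    calc volume B = ∫⁻ _ in B, 1 := by simp
      _ ≤ ∫⁻ y in B, ENNReal.ofReal L * volume (Prod.mk y ⁻¹' T) :=
        setLIntegral_mono' Metric.isClosed_closedBall.measurableSet hfib1
      _ ≤ ∫⁻ y, ENNReal.ofReal L * volume (Prod.mk y ⁻¹' T) := setLIntegral_le_lintegral _ _
      _ = ENNReal.ofReal L * volume T := by
        rw [lintegral_const_mul' _ _ ENNReal.ofReal_ne_top, Measure.volume_eq_prod,
          Measure.prod_apply hTm]
      _ = ENNReal.ofReal L * ∫⁻ t, volume ((fun y => (y, t)) ⁻¹' T) := by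
        rw [Measure.volume_eq_prod, Measure.prod_apply_symm hTm]
      _ ≤ ENNReal.ofReal L * ∫⁻ t, (C : ENNReal) ^ n * volume ((fun x => (x, t)) ⁻¹' E) := by
        gcongr with t
        exact hfib2 t
      _ = ENNReal.ofReal L * ((C : ENNReal) ^ n * volume E) := by
        rw [lintegral_const_mul' _ _ (by simp), Measure.volume_eq_prod,
          Measure.prod_apply_symm hEm]
  refine le_trans ?_ (measure_mono hEsub)
  rw [ENNReal.ofReal_div_of_pos (by positivity), ENNReal.ofReal_toReal hBtop]
  refine ENNReal.div_le_of_le_mul' ?_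
  rw [ENNReal.ofReal_mul hL0.le, ENNReal.ofReal_pow (by positivity), ENNReal.ofReal_coe_nnreal,
    mul_assoc]
  exact hmain
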